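/- Let $N\ge 1$, $1\le n\le N$, and let $k_1,k_2,k_3\in\mathbb R$ with $k_3>0$, $k_2>-1/2$ and $k_1+k_2>-1/2$. Let $R_+=\{e_i,\,2e_i \ (1\le i\le N),\ e_i\pm e_j\ (1\le i<j\le N)\}$ be the positive roots of type $BC_N$, with multiplicities $k_1,k_2,k_3$ on $e_i$, $2e_i$, $e_i\pm e_j$, and let $W$ be the group of permutations and sign changes of coordinates. For a partition $\lambda\in\mathbb Z_+^N$, $\lambda_1\ge\dots\ge\lambda_N\ge0$, put $M_\lambda(t)=\sum_{\mu\in W\lambda}e^{i\langle\mu,t\rangle}$, and write $\nu<\lambda$ if $\lambda-\nu$ is a nonzero sum of positive roots. The Heckman–Opdam polynomial $P_\lambda=M_\lambda+\sum_{\nu<\lambda}c_{\lambda\nu}M_\nu$ (sum over partitions $\nu$, $c_{\lambda\nu}\in\mathbb R$) is determined by being orthogonal to all $M_\nu$, $\nu<\lambda$, in $L^2\big((\mathbb R/2\pi\mathbb Z)^N,\delta_k\big)$, where $\delta_k(t)=\prod_{\alpha\in R_+}|\sin(\langle\alpha,t\rangle/2)|^{2k_\alpha}$. Whenever $P_\lambda(0)\neq0$,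 the normalized polynomial $\widetilde R_\lambda$ in $N$ variables is defined by $\widetilde R_\lambda(\cos t_1,\dots,\cos t_N)=P_\lambda(t)/P_\lambda(0)$. Put $$p=N-1+\frac{1+2k_2}{2k_3},\qquad q=N-1+\frac{1+2k_1+2k_2}{2k_3},$$ let $e_m$ be the elementary symmetric polynomials in $N$ variables, and let $$q_n=e_n+\sum_{l=1}^n c_{n,l}\,e_{n-l},$$ where $c_{n,0}=1$, $\;c_{n,1}=-\dfrac{(p-q)(N-n+1)}{p+q-2n+2}$ and, for $l\ge2$, $$c_{n,l}=\frac{-(p-q)(N-n+l)\,c_{n,l-1}+(N-n+l)(N-n+l-1)\,c_{n,l-2}}{l\,(p+q-2n+l+1)}.$$ Let $\lambda(n)=(1,\dots,1,0,\dots,0)$ with $n$ ones. Then $\widetilde R_{\lambda(n)}$ exists and is unique, and $\widetilde R_{\lambda(n)}=C\,q_n$ for some real constant $C\ne0$. In particular, $\widetilde R_{\lambda(n)}$ is independent of $k_3$ when it is parametrized by $(k_3,p,q)$ in place of $(k_1,k_2,k_3)$: two admissible triples of multiplicities with the same $p$ and $q$ give the same polynomial $\widetilde R_{\lambda(n)}$.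 -/

import Mathlib

noncomputable section

/-- The positive roots `e_i`, `2 e_i` and `e_i ± e_j` (`i < j`) of the root system `BC_N`. -/
def bcPositiveRoots (N : ℕ) : Set (Fin N → ℤ) :=
  {α | (∃ i, α = Pi.single i 1) ∨ (∃ i, α = Pi.single i 2) ∨
    (∃ i j, i < j ∧ α = Pi.single i 1 - Pi.single j 1) ∨
    (∃ i j, i < j ∧ α = Pi.single i 1 + Pi.single j 1)}

/-- The dominant weights of `BC_N`: integral vectors with `lam_1 ≥ … ≥ lam_N ≥ 0`. -/
def IsBCDominant {N : ℕ} (lam : Fin N → ℤ) : Prop :=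
  Antitone lam ∧ ∀ i, 0 ≤ lam i

/-- The strict dominance order: `nu < lam` iff `lam - nu` is a nonzero sum of positive roots. -/
def BCDominanceLT {N : ℕ} (nu lam : Fin N → ℤ) : Prop :=
  nu ≠ lam ∧ lam - nu ∈ AddSubmonoid.closure (bcPositiveRoots N)

/-- The orbit of a weight under the Weyl group of `BC_N`, which acts on `ℤ^N` by permutations
and sign changes of the coordinates. -/
def bcOrbit {N : ℕ} (nu : Fin N → ℤ) : Finset (Fin N → ℤ) :=
  Finset.univ.image
    (fun g : Equiv.Perm (Fin N) × (Fin N → ℤˣ) => fun i => (g.2 i : ℤ) * nu (g.1 i))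

/-- The orbit sum `M_nu(t) = ∑_{mu ∈ W nu} exp(i ⟨mu, t⟩)`. -/
def bcOrbitSum {N : ℕ} (nu : Fin N → ℤ) (t : Fin N → ℝ) : ℂ :=
  ∑ mu ∈ bcOrbit nu, Complex.exp (Complex.I * ((∑ i, (mu i : ℝ) * t i : ℝ) : ℂ))

/-- The weight `∏_{α ∈ R₊} |sin(⟨α, t⟩ / 2)| ^ (2 k_α)` on the torus, where `k₁`, `k₂`, `k₃` are
the multiplicities of the roots `e_i`, `2 e_i` and `e_i ± e_j`. -/
def bcWeight {N : ℕ} (k₁ k₂ k₃ : ℝ) (t : Fin N → ℝ) : ℝ :=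
  (∏ i, |Real.sin (t i / 2)| ^ (2 * k₁) * |Real.sin (t i)| ^ (2 * k₂)) *
    ∏ i, ∏ j ∈ Finset.Ioi i,
      |Real.sin ((t i - t j) / 2)| ^ (2 * k₃) * |Real.sin ((t i + t j) / 2)| ^ (2 * k₃)

/-- `P` is the Heckman–Opdam polynomial `P_lam` of type `BC_N`, as a function on `ℝ^N`:
`P = M_lam + ∑_{nu < lam} c_nu M_nu` with real `c_nu`, and `P` is orthogonal to every `M_nu` with
`nu` dominant and `nu < lam`, in `L²` of the torus `(ℝ / 2πℤ)^N` with the weight above. -/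
def IsHeckmanOpdamPolynomial {N : ℕ} (k₁ k₂ k₃ : ℝ) (lam : Fin N → ℤ)
    (P : (Fin N → ℝ) → ℂ) : Prop :=
  P - bcOrbitSum lam ∈ Submodule.span ℝ
      {f : (Fin N → ℝ) → ℂ | ∃ nu, IsBCDominant nu ∧ BCDominanceLT nu lam ∧ f = bcOrbitSum nu} ∧
  ∀ nu : Fin N → ℤ, IsBCDominant nu → BCDominanceLT nu lam →
    MeasureTheory.IntegrableOn
      (fun t => P t * (starRingEnd ℂ) (bcOrbitSum nu t) * (bcWeight k₁ k₂ k₃ t : ℂ))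
      (Set.Icc 0 (fun _ => 2 * Real.pi)) ∧
    ∫ t in Set.Icc (0 : Fin N → ℝ) (fun _ => 2 * Real.pi),
      P t * (starRingEnd ℂ) (bcOrbitSum nu t) * (bcWeight k₁ k₂ k₃ t : ℂ) = 0

/-- `R` is the normalized Heckman–Opdam Jacobi polynomial in algebraic coordinates:
`R(cos t_1, …, cos t_N) = P_lam(t) / P_lam(0)`. -/
def IsNormalizedJacobiBC {N : ℕ} (k₁ k₂ k₃ : ℝ) (lam : Fin N → ℤ)
    (R : MvPolynomial (Fin N) ℝ) : Prop :=
  ∃ P : (Fin N → ℝ) → ℂ, IsHeckmanOpdamPolynomial k₁ k₂ k₃ lam P ∧ P 0 ≠ 0 ∧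
    ∀ t : Fin N → ℝ, ((MvPolynomial.eval (fun i => Real.cos (t i)) R : ℝ) : ℂ) = P t / P 0

/-- The partition `(1, …, 1, 0, …, 0)` with `n` ones. -/
def columnPartition (N n : ℕ) : Fin N → ℤ := fun i => if (i : ℕ) < n then 1 else 0

/-- The parameter `p = N - 1 + (1 + 2 k₂) / (2 k₃)`. -/
def jacobiP (N : ℕ) (k₂ k₃ : ℝ) : ℝ := N - 1 + (1 + 2 * k₂) / (2 * k₃)

/-- The parameter `q = N - 1 + (1 + 2 k₁ + 2 k₂) / (2 k₃)`. -/
def jacobiQ (N : ℕ) (k₁ k₂ k₃ : ℝ) : ℝ := N - 1 + (1 + 2 * k₁ + 2 * k₂) / (2 * k₃)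

/-- The coefficients `c_{n,l}`, as functions of `N`, `p`, `q`, `n` and `l`. -/
def jacobiCoeff (N : ℕ) (p q : ℝ) (n : ℕ) : ℕ → ℝ
  | 0 => 1
  | 1 => -((p - q) * (N - n + 1)) / (p + q - 2 * n + 2)
  | l + 2 =>
    (-((p - q) * (N - n + (l + 2)) * jacobiCoeff N p q n (l + 1)) +
        (N - n + (l + 2)) * (N - n + (l + 2) - 1) * jacobiCoeff N p q n l) /
      ((l + 2) * (p + q - 2 * n + (l + 2) + 1))

/-- `q_n = e_n + ∑_{l=1}^n c_{n,l} e_{n-l}` in `N` variables. -/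
def jacobiElementary (N : ℕ) (p q : ℝ) (n : ℕ) : MvPolynomial (Fin N) ℝ :=
  MvPolynomial.esymm (Fin N) ℝ n +
    ∑ l ∈ Finset.Icc 1 n,
      MvPolynomial.C (jacobiCoeff N p q n l) * MvPolynomial.esymm (Fin N) ℝ (n - l)

end

/-! In the coordinates `x_i = cos t_i` the orbit sum of `columnPartition N m` is `2^m e_m(x)`, and
the dominant weights strictly below `columnPartition N n` are the shorter columns. The whole problem
thus lives in the span of `e_0, …, e_n`, that is, among multilinear symmetric polynomials,
represented by coefficient sequences through `symmSum`.

Up to a constant the weight is `∏ (1 - x_i)^s (1 + x_i)^b ∏_{i<j} |x_i - x_j|^{2k}` with `s = k₁ +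
k₂`, `b = k₂`, `k = k₃`. The Jacobi operator symmetric for it preserves this span: it sends `e_m` to
`jacobiEigenvalue m • e_m` plus multiples of `e_{m-1}` and `e_{m-2}` (`jacobi_operator_symmSum`).
The recursion for `c_{n,l}`, multiplied by `k₃`, is the eigenvector equation for this triangular
operator (`jacobiShift_jacobiSeq`). After division by `k₃` its coefficients involve only `p` and
`q`, which explains the independence of `k₃`.

Symmetry (`integral_jacobiWeight_symmetric`) is Green's identity, obtained from the divergence
theorem for a smooth regularization of the weight and dominated convergence. Since the eigenvalues
strictly increase, an eigenvector of degree `n` is orthogonal to everything of lower degree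
(`jacobiPairing_eq_zero_of_eigenvector`); with positivity of the pairing this identifies `P_λ` with
`2^n q_n`.

Normalization needs `q_n(1, …, 1) ≠ 0`. On the diagonal `q_n` becomes a one-variable polynomial
satisfying a Jacobi-type differential equation, which forces its value at `1` to be positive
(`symmSum_one_pos`). -/

/-- The multilinear symmetric polynomial `∑_{S ⊆ s} a_{|S|} ∏_{i ∈ S} x_i`. -/
def symmSum {ι : Type*} (s : Finset ι) (a : ℕ → ℝ) (x : ι → ℝ) : ℝ :=
  ∑ S ∈ s.powerset, a S.card * ∏ i ∈ S, x i

/-! ### Multilinear symmetric polynomials in terms of their coefficients. -/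

section SymmSum

variable {ι : Type*}

theorem symmSum_add (s : Finset ι) (a b : ℕ → ℝ) (x : ι → ℝ) :
    symmSum s (a + b) x = symmSum s a x + symmSum s b x := by
  simp [symmSum, add_mul, Finset.sum_add_distrib]

theorem symmSum_smul (s : Finset ι) (c : ℝ) (a : ℕ → ℝ) (x : ι → ℝ) :
    symmSum s (c • a) x = c * symmSum s a x := by
  simp [symmSum, Finset.mul_sum, mul_assoc]

theorem continuous_symmSum (s : Finset ι) (a : ℕ → ℝ) : Continuous (symmSum s a) := by
  unfold symmSum
  fun_prop

theorem differentiable_symmSum [Fintype ι] (s : Finset ι) (a : ℕ → ℝ) :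
    Differentiable ℝ (symmSum s a) := by
  unfold symmSum
  fun_prop

theorem symmSum_single (s : Finset ι) (m : ℕ) (c : ℝ) (x : ι → ℝ) :
    symmSum s (Pi.single m c) x = c * ∑ S ∈ s.powersetCard m, ∏ i ∈ S, x i := by
  classical
  rw [symmSum, Finset.powersetCard_eq_filter, Finset.sum_filter, Finset.mul_sum]
  refine Finset.sum_congr rfl fun S _ => ?_
  by_cases h : S.card = m
  · simp [h]
  · simp [h]

theorem symmSum_const (s : Finset ι) (a : ℕ → ℝ) (r : ℝ) :
    symmSum s a (fun _ => r) = ∑ m ∈ Finset.range (s.card + 1), s.card.choose m * a m * r ^ m := by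
  have h := Finset.sum_powerset_apply_card (fun m => a m * r ^ m) (x := s)
  simp only [symmSum, Finset.prod_const]
  rw [h]
  exact Finset.sum_congr rfl fun m _ => by rw [nsmul_eq_mul, mul_assoc]

theorem symmSum_congr_arg {s : Finset ι} (a : ℕ → ℝ) {x y : ι → ℝ} (h : ∀ i ∈ s, x i = y i) :
    symmSum s a x = symmSum s a y :=
  Finset.sum_congr rfl fun S hS => by
    rw [Finset.prod_congr rfl fun i hi => h i (Finset.mem_powerset.1 hS hi)]

variable [DecidableEq ι]

/-- The polynomial is affine in each variable, so both `x_i`-coefficients are again of the form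
`symmSum`, the linear one with shifted sequence; that one is also the partial derivative in `x_i`.
-/
theorem symmSum_insert {s : Finset ι} {i : ι} (hi : i ∉ s) (a : ℕ → ℝ) (x : ι → ℝ) :
    symmSum (insert i s) a x = symmSum s a x + x i * symmSum s (fun m => a (m + 1)) x := by
  rw [symmSum, Finset.sum_powerset_insert hi, symmSum, symmSum, Finset.mul_sum]
  congr 1
  refine Finset.sum_congr rfl fun S hS => ?_
  have hiS : i ∉ S := fun h => hi (Finset.mem_powerset.1 hS h)
  rw [Finset.card_insert_of_notMem hiS, Finset.prod_insert hiS]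
  ring

theorem symmSum_erase {s : Finset ι} {i : ι} (hi : i ∈ s) (a : ℕ → ℝ) (x : ι → ℝ) :
    symmSum s a x =
      symmSum (s.erase i) a x + x i * symmSum (s.erase i) (fun m => a (m + 1)) x := by
  conv_lhs => rw [← Finset.insert_erase hi]
  exact symmSum_insert (Finset.notMem_erase i s) a x

/-- A subset `S` survives the removal of `i` exactly when `i ∉ S`, so it is counted `s.card - |S|`
times. -/
theorem sum_symmSum_erase (s : Finset ι) (a : ℕ → ℝ) (x : ι → ℝ) :
    ∑ i ∈ s, symmSum (s.erase i) a x = symmSum s (fun m => (s.card - m) * a m) x := by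
  simp only [symmSum]
  rw [Finset.sum_comm' (t' := s.powerset) (s' := fun S => s \ S)]
  · refine Finset.sum_congr rfl fun S hS => ?_
    have hS' := Finset.mem_powerset.1 hS
    rw [Finset.sum_const, Finset.card_sdiff_of_subset hS', nsmul_eq_mul,
      Nat.cast_sub (Finset.card_le_card hS'), mul_assoc]
  · intro i S
    simp only [Finset.mem_powerset, Finset.mem_sdiff, Finset.subset_erase]
    tauto

/-- This is the Euler operator `∑ x_i ∂_i`, which multiplies the degree `m` part by `m`. -/
theorem sum_mul_symmSum_erase (s : Finset ι) (a : ℕ → ℝ) (x : ι → ℝ) :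
    ∑ i ∈ s, x i * symmSum (s.erase i) (fun m => a (m + 1)) x =
      symmSum s (fun m => m * a m) x := by
  have h1 : ∀ i ∈ s, x i * symmSum (s.erase i) (fun m => a (m + 1)) x =
      symmSum s a x - symmSum (s.erase i) a x := fun i hi => by
    rw [symmSum_erase hi a x]; ring
  rw [Finset.sum_congr rfl h1, Finset.sum_sub_distrib, sum_symmSum_erase, Finset.sum_const,
    nsmul_eq_mul]
  simp only [symmSum, Finset.mul_sum, ← Finset.sum_sub_distrib]
  exact Finset.sum_congr rfl fun S _ => by ring

end SymmSum

theorem sum_Ioi_eq_half_sum_erase {N : ℕ} (F : Fin N → Fin N → ℝ) (hF : ∀ i j, F i j = F j i) :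
    ∑ i, ∑ j ∈ Finset.Ioi i, F i j = (∑ i, ∑ j ∈ Finset.univ.erase i, F i j) / 2 := by
  have h1 : ∀ i, ∑ j ∈ Finset.univ.erase i, F i j =
      ∑ j ∈ Finset.Ioi i, F i j + ∑ j ∈ Finset.Iio i, F i j := fun i => by
    rw [← Finset.sum_union]
    · refine Finset.sum_congr ?_ fun _ _ => rfl
      ext j
      simp only [Finset.mem_erase, Finset.mem_univ, and_true, Finset.mem_union, Finset.mem_Ioi,
        Finset.mem_Iio]
      rw [ne_iff_lt_or_gt]
      tauto
    · exact Finset.disjoint_left.2 fun j hj hj' =>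
        lt_asymm (Finset.mem_Ioi.1 hj) (Finset.mem_Iio.1 hj')
  have h2 : ∑ i, ∑ j ∈ Finset.Iio i, F i j = ∑ i, ∑ j ∈ Finset.Ioi i, F i j := by
    rw [Finset.sum_comm' (t' := Finset.univ) (s' := fun j => Finset.Ioi j)]
    · exact Finset.sum_congr rfl fun i _ => Finset.sum_congr rfl fun j _ => hF _ _
    · intro i j
      simp
  simp only [h1, Finset.sum_add_distrib, h2]
  ring

/-! ### The Jacobi operator on multilinear symmetric polynomials. -/

/-- The eigenvalue `m (s + b + 1 + k (2 N - 1 - m))` of the Jacobi operator. -/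
def jacobiEigenvalue (N : ℕ) (s b k : ℝ) (m : ℕ) : ℝ :=
  m * (s + b + 1 + k * (2 * N - 1 - m))

/-- The action of the Jacobi operator on the coefficients of a multilinear symmetric
polynomial. -/
def jacobiShift (N : ℕ) (s b k : ℝ) (a : ℕ → ℝ) (m : ℕ) : ℝ :=
  jacobiEigenvalue N s b k m * a m + (s - b) * (N - m) * a (m + 1) +
    k * ((N - m) * (N - m - 1)) * a (m + 2)

section JacobiOperator

variable {N : ℕ}

/-- The partial derivative `∂_i` of `symmSum Finset.univ a`. -/
def symmSumDeriv (a : ℕ → ℝ) (i : Fin N) (x : Fin N → ℝ) : ℝ :=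
  symmSum (Finset.univ.erase i) (fun m => a (m + 1)) x

/-- The quotient of `(1 - x_i²) ∂_i f - (1 - x_j²) ∂_j f` by `x_i - x_j`, for
`f = symmSum Finset.univ a`. -/
def symmSumPair (a : ℕ → ℝ) (i j : Fin N) (x : Fin N → ℝ) : ℝ :=
  symmSum ((Finset.univ.erase i).erase j) a x - symmSum Finset.univ a x -
    symmSum ((Finset.univ.erase i).erase j) (fun m => a (m + 2)) x

/-- Write `f = A + (x_i + x_j) B + x_i x_j C` with `A, B, C` free of `x_i, x_j`. The difference on
the right is divisible by `x_i - x_j`, with quotient `-(x_i + x_j) B - x_i x_j C - C = A - f - C`.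
-/
theorem sub_mul_symmSumPair (a : ℕ → ℝ) {i j : Fin N} (hij : i ≠ j) (x : Fin N → ℝ) :
    (x i - x j) * symmSumPair a i j x =
      (1 - x i ^ 2) * symmSumDeriv a i x - (1 - x j ^ 2) * symmSumDeriv a j x := by
  have hj : j ∈ Finset.univ.erase i := by simp [hij.symm]
  have hi : i ∈ Finset.univ.erase j := by simp [hij]
  rw [symmSumPair, symmSumDeriv, symmSumDeriv, symmSum_erase (Finset.mem_univ i) a,
    symmSum_erase hj, symmSum_erase hj, symmSum_erase hi, Finset.erase_right_comm (a := j)]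
  ring

/-- The second-order part of the Jacobi operator is absent because `∂_i² f = 0` for multilinear `f`.
The rest is a count: a subset of size `m` avoids `(N - m)(N - m - 1) / 2` of the pairs `i < j`, and
`N(N - 1) - (N - m)(N - m - 1) = m(2N - 1 - m)` gives the eigenvalue. -/
theorem jacobi_operator_symmSum (s b k : ℝ) (a : ℕ → ℝ) (x : Fin N → ℝ) :
    ∑ i, (x i + s * (1 + x i) - b * (1 - x i)) * symmSumDeriv a i x -
        2 * k * ∑ i, ∑ j ∈ Finset.Ioi i, symmSumPair a i j x =
      symmSum Finset.univ (jacobiShift N s b k a) x := by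
  have h1 : ∑ i, (x i + s * (1 + x i) - b * (1 - x i)) * symmSumDeriv a i x =
      (s + b + 1) * symmSum Finset.univ (fun m => m * a m) x +
        (s - b) * symmSum Finset.univ (fun m => (N - m) * a (m + 1)) x := by
    have e1 := sum_symmSum_erase Finset.univ (fun m => a (m + 1)) x
    have e2 := sum_mul_symmSum_erase Finset.univ a x
    rw [Finset.card_univ, Fintype.card_fin] at e1
    rw [← e1, ← e2, Finset.mul_sum, Finset.mul_sum, ← Finset.sum_add_distrib]
    exact Finset.sum_congr rfl fun i _ => by rw [symmSumDeriv]; ring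
  have h2 : ∀ c : ℕ → ℝ, ∑ i : Fin N, ∑ j ∈ Finset.Ioi i,
      symmSum ((Finset.univ.erase i).erase j) c x =
        symmSum Finset.univ (fun m => (N - m) * (N - 1 - m) * c m) x / 2 := fun c => by
    rw [sum_Ioi_eq_half_sum_erase _ fun i j => by rw [Finset.erase_right_comm]]
    congr 1
    have e1 := sum_symmSum_erase (Finset.univ : Finset (Fin N)) (fun m => (N - 1 - m) * c m) x
    rw [Finset.card_univ, Fintype.card_fin] at e1
    simp only [mul_assoc]
    rw [← e1]
    refine Finset.sum_congr rfl fun i _ => ?_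
    rw [sum_symmSum_erase, Finset.card_erase_of_mem (Finset.mem_univ i), Finset.card_univ,
      Fintype.card_fin, Nat.cast_pred (Fin.pos i)]
  have h3 : ∑ i : Fin N, ∑ j ∈ Finset.Ioi i, symmSum Finset.univ a x =
      symmSum Finset.univ (fun m => N * (N - 1) * a m) x / 2 := by
    rw [sum_Ioi_eq_half_sum_erase _ fun i j => rfl]
    congr 1
    have e1 : symmSum Finset.univ (fun m => (N * (N - 1) : ℝ) * a m) x =
      (N * (N - 1)) * symmSum Finset.univ a x := symmSum_smul _ (N * (N - 1) : ℝ) a x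
    rw [e1]
    simp only [Finset.sum_const, Finset.card_erase_of_mem (Finset.mem_univ _), Finset.card_univ,
      Fintype.card_fin, nsmul_eq_mul]
    rcases N.eq_zero_or_pos with rfl | hN
    · simp
    · rw [Nat.cast_pred hN]; ring
  rw [h1]
  simp only [symmSumPair, Finset.sum_sub_distrib, h2, h3]
  simp only [symmSum, Finset.mul_sum, Finset.sum_div, ← Finset.sum_sub_distrib,
    ← Finset.sum_add_distrib]
  refine Finset.sum_congr rfl fun S _ => ?_
  rw [jacobiShift, jacobiEigenvalue]
  ring

end JacobiOperator

/-! ### The recursion for `c_{n,l}` as an eigenvector equation. -/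

/-- The coefficients of `jacobiElementary`, indexed by the degree of the elementary symmetric
polynomial. -/
noncomputable def jacobiSeq (N : ℕ) (p q : ℝ) (n m : ℕ) : ℝ :=
  if m ≤ n then jacobiCoeff N p q n (n - m) else 0

theorem jacobiSeq_self (N : ℕ) (p q : ℝ) (n : ℕ) : jacobiSeq N p q n n = 1 := by
  simp [jacobiSeq, jacobiCoeff]

theorem jacobiSeq_of_lt (N : ℕ) (p q : ℝ) {n m : ℕ} (h : n < m) : jacobiSeq N p q n m = 0 :=
  if_neg (not_le.2 h)

theorem jacobiEigenvalue_sub {N : ℕ} (s b k : ℝ) (n m : ℕ) :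
    jacobiEigenvalue N s b k n - jacobiEigenvalue N s b k m =
      (n - m) * (s + b + 1 + k * (2 * N - 1 - n - m)) := by
  simp only [jacobiEigenvalue]
  ring

theorem jacobiEigenvalue_lt {N : ℕ} {s b k : ℝ} (hk : 0 < k) (hs : -1 / 2 < s) (hb : -1 / 2 < b)
    {n m : ℕ} (hm : m < n) (hn : n ≤ N) :
    jacobiEigenvalue N s b k m < jacobiEigenvalue N s b k n := by
  rw [← sub_pos, jacobiEigenvalue_sub]
  have h1 : (m : ℝ) + 1 ≤ n := by exact_mod_cast hm
  have h2 : (n : ℝ) ≤ N := by exact_mod_cast hn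
  have h3 : 0 ≤ k * (2 * N - 1 - n - m) := mul_nonneg hk.le (by linarith)
  exact mul_pos (by linarith) (by linarith)

theorem eval_jacobiElementary (N : ℕ) (p q : ℝ) (n : ℕ) (x : Fin N → ℝ) :
    MvPolynomial.eval x (jacobiElementary N p q n) =
      symmSum Finset.univ (jacobiSeq N p q n) x := by
  have h0 : jacobiSeq N p q n = ∑ l ∈ Finset.range (n + 1),
      (Pi.single (n - l) (jacobiCoeff N p q n l) : ℕ → ℝ) := by
    funext m
    rw [Finset.sum_apply]
    by_cases hm : m ≤ n
    · rw [jacobiSeq, if_pos hm, Finset.sum_eq_single (n - m)]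
      · rw [Nat.sub_sub_self hm, Pi.single_eq_same]
      · intro l hl hne
        exact Pi.single_eq_of_ne (by have := Finset.mem_range.1 hl; omega) _
      · intro h
        exact absurd (Finset.mem_range.2 (by omega)) h
    · rw [jacobiSeq, if_neg hm, Finset.sum_eq_zero]
      intro l _
      exact Pi.single_eq_of_ne (by omega) _
  have h1 : ∀ (t : Finset ℕ) (c : ℕ → ℕ → ℝ),
      symmSum Finset.univ (∑ l ∈ t, c l) x = ∑ l ∈ t, symmSum Finset.univ (c l) x := by
    intro t c
    induction t using Finset.cons_induction with
    | empty => simp [symmSum]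
    | cons l t hl ih => rw [Finset.sum_cons, Finset.sum_cons, symmSum_add, ih]
  rw [h0, h1, Finset.sum_range_succ', jacobiElementary, map_add, map_sum, add_comm]
  congr 1
  · rw [Finset.range_eq_Ico, Finset.sum_Ico_add' (fun l => symmSum Finset.univ
      (Pi.single (n - l) (jacobiCoeff N p q n l)) x) 0 n 1]
    refine Finset.sum_congr ?_ fun l _ => ?_
    · ext l; simp only [Finset.mem_Icc, Finset.mem_Ico]; omega
    · simp [symmSum_single, MvPolynomial.esymm]
  · simp [symmSum_single, MvPolynomial.esymm, jacobiCoeff]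

/-- For `l ≤ n`, `k₃ l` times this quantity is the eigenvalue gap between degrees `n` and `n - l`;
positivity makes every division in the recursion genuine. -/
theorem jacobi_denominator_pos {N n : ℕ} (hn : n ≤ N) {k₁ k₂ k₃ : ℝ} (hk₃ : 0 < k₃)
    (hk₂ : -1 / 2 < k₂) (hk₁₂ : -1 / 2 < k₁ + k₂) {l : ℕ} (hl : 1 ≤ l) :
    0 < jacobiP N k₂ k₃ + jacobiQ N k₁ k₂ k₃ - 2 * n + l + 1 := by
  have h1 : (1 : ℝ) ≤ l := by exact_mod_cast hl
  have h2 : (n : ℝ) ≤ N := by exact_mod_cast hn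
  have h3 : jacobiP N k₂ k₃ + jacobiQ N k₁ k₂ k₃ - 2 * n + l + 1 =
      2 * (N - n) + (l - 1) + ((1 + 2 * k₂) + (1 + 2 * k₁ + 2 * k₂)) / (2 * k₃) := by
    rw [jacobiP, jacobiQ]
    ring
  rw [h3]
  have h4 : 0 < ((1 + 2 * k₂) + (1 + 2 * k₁ + 2 * k₂)) / (2 * k₃) :=
    div_pos (by linarith) (by linarith)
  linarith

/-- With `s - b = k₁ = -k₃ (p - q)` and `λ_n - λ_{n-l} = k₃ l (p + q - 2n + l + 1)`, the degree `n -
l` component of the eigenvector equation is `k₃` times the recursion. Components in degree `n` and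
above are trivial. -/
theorem jacobiShift_jacobiSeq {N n : ℕ} (hn : n ≤ N) {k₁ k₂ k₃ : ℝ} (hk₃ : 0 < k₃)
    (hk₂ : -1 / 2 < k₂) (hk₁₂ : -1 / 2 < k₁ + k₂) :
    jacobiShift N (k₁ + k₂) k₂ k₃ (jacobiSeq N (jacobiP N k₂ k₃) (jacobiQ N k₁ k₂ k₃) n) =
      jacobiEigenvalue N (k₁ + k₂) k₂ k₃ n •
        jacobiSeq N (jacobiP N k₂ k₃) (jacobiQ N k₁ k₂ k₃) n := by
  funext m
  have hpq : k₃ * (jacobiP N k₂ k₃ - jacobiQ N k₁ k₂ k₃) = -k₁ := by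
    rw [jacobiP, jacobiQ]
    field_simp
    ring
  have hpq' : k₃ * (jacobiP N k₂ k₃ + jacobiQ N k₁ k₂ k₃) = 2 * k₃ * (N - 1) + 1 + k₁ + 2 * k₂ := by
    rw [jacobiP, jacobiQ]
    field_simp
    ring
  have hd := fun l hl => jacobi_denominator_pos (l := l) hn hk₃ hk₂ hk₁₂ hl
  generalize jacobiP N k₂ k₃ = p at *
  generalize jacobiQ N k₁ k₂ k₃ = q at *
  rw [jacobiShift, Pi.smul_apply, smul_eq_mul]
  have hν := jacobiEigenvalue_sub (N := N) (k₁ + k₂) k₂ k₃ n m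
  rcases lt_trichotomy m n with h | rfl | h
  · obtain ⟨l, rfl⟩ := Nat.exists_eq_add_of_lt h
    have e0 : ∀ c : ℕ, jacobiSeq N p q (m + l + 1) (m + c) =
        if c ≤ l + 1 then jacobiCoeff N p q (m + l + 1) (l + 1 - c) else 0 := fun c => by
      rw [jacobiSeq, show m + l + 1 - (m + c) = l + 1 - c by omega]
      exact if_congr (by omega) rfl rfl
    have e1 := e0 0
    rw [add_zero, if_pos (Nat.zero_le _), Nat.sub_zero] at e1
    rw [e1, e0 1, e0 2, if_pos (by omega), Nat.add_sub_cancel]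
    have hd' := (hd (l + 1) (by omega)).ne'
    -- Here `n = m + l + 1`, so the recursion index is `l + 1`. When it equals `1`, degree `m + 2`
    -- exceeds `n` and contributes nothing, matching the separate formula for `c_{n,1}`.
    rcases l with _ | l
    · rw [if_neg (by norm_num), jacobiCoeff, zero_add, jacobiCoeff]
      push_cast at hν hd' ⊢
      have hd2 : p + q - 2 * (m + 0 + 1) + 2 ≠ 0 := by convert! hd' using 1; ring
      generalize hcd : (-((p - q) * (N - (m + 0 + 1) + 1)) / (p + q - 2 * (m + 0 + 1) + 2) : ℝ) = c
      rw [div_eq_iff hd2] at hcd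
      linear_combination k₃ * hcd - c * hν + (N - m) * hpq + c * hpq'
    · rw [if_pos (by omega), show l + 1 + 1 - 2 = l by omega, jacobiCoeff]
      push_cast at hν hd' ⊢
      have hd2 : ((l : ℝ) + 2) * (p + q - 2 * (m + (l + 1) + 1) + (l + 2) + 1) ≠ 0 := by
        refine mul_ne_zero (by positivity) ?_
        convert! hd' using 1; ring
      generalize hc1 : jacobiCoeff N p q (m + (l + 1) + 1) (l + 1) = c1
      generalize hc0 : jacobiCoeff N p q (m + (l + 1) + 1) l = c0
      generalize hcd : ((-((p - q) * (N - (m + (l + 1) + 1) + (l + 2)) * c1) +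
        (N - (m + (l + 1) + 1) + (l + 2)) * (N - (m + (l + 1) + 1) + (l + 2) - 1) * c0) /
          (((l : ℝ) + 2) * (p + q - 2 * (m + (l + 1) + 1) + (l + 2) + 1))) = c
      rw [div_eq_iff hd2] at hcd
      linear_combination k₃ * hcd - c * hν + (N - m) * c1 * hpq + c * (l + 2) * hpq'
  · rw [jacobiSeq_of_lt _ _ _ (Nat.lt_succ_self m),
      jacobiSeq_of_lt _ _ _ (show m < m + 2 by omega)]
    ring
  · rw [jacobiSeq_of_lt _ _ _ h, jacobiSeq_of_lt _ _ _ (show n < m + 1 by omega),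
      jacobiSeq_of_lt _ _ _ (show n < m + 2 by omega)]
    ring

/-! ### Positivity at the point `(1, …, 1)`. -/

open Polynomial in
theorem jacobi_derivative_ode {k γ β ν : ℝ} {Q : ℝ[X]}
    (h : C k * (1 - X ^ 2) * derivative (derivative Q) + (C γ + C β * X) * derivative Q =
      C ν * Q) (j : ℕ) :
    C k * (1 - X ^ 2) * derivative^[j + 2] Q +
        (C γ + C (β - 2 * k * j) * X) * derivative^[j + 1] Q =
      C (ν - j * (β + k * (1 - j))) * derivative^[j] Q := by
  induction j with
  | zero => simpa using h
  | succ j ih =>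
    have h2 := congrArg derivative ih
    simp only [derivative_mul, derivative_add, derivative_sub, derivative_C, derivative_X,
      derivative_X_pow, derivative_one, ← Function.iterate_succ_apply' derivative] at h2
    simp only [Nat.succ_eq_add_one, map_sub, map_add, map_mul, map_one, map_natCast,
      Nat.cast_add, Nat.cast_one, Nat.cast_ofNat, map_ofNat] at h2 ⊢
    linear_combination h2

-- The restriction `Q` to the diagonal satisfies a second-order equation; differentiate it `j` times
-- and set `X = 1`, where the leading term drops out. This leaves `(λ_n - λ_j) Q^(j)(1) = (2s + 1 +
-- 2k(N - 1 - j)) Q^(j+1)(1)` with both factors positive for `j < n`. Positivity descends from the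
-- constant `Q^(n)` to `Q` itself.
open Polynomial in
theorem symmSum_one_pos {N n : ℕ} (hn : n ≤ N) {s b k : ℝ} (hk : 0 < k) (hs : -1 / 2 < s)
    (hb : -1 / 2 < b) {a : ℕ → ℝ} (ha : jacobiShift N s b k a = jacobiEigenvalue N s b k n • a)
    (han : a n = 1) (ha0 : ∀ m, n < m → a m = 0) :
    0 < symmSum (Finset.univ : Finset (Fin N)) a (fun _ => 1) := by
  set Q : ℝ[X] := ∑ m ∈ Finset.range (N + 1), C (N.choose m * a m) * X ^ m with hQ
  have hcoeff : ∀ m, Q.coeff m = N.choose m * a m := by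
    intro m
    rw [hQ, finsetSum_coeff]
    simp only [coeff_C_mul_X_pow]
    rw [Finset.sum_ite_eq]
    split_ifs with h
    · rfl
    · rw [Nat.choose_eq_zero_of_lt (by simpa using h)]; simp
  have hch : ∀ m : ℕ, (N.choose (m + 1) : ℝ) * (m + 1) = N.choose m * (N - m) := by
    intro m
    rcases le_or_gt m N with h | h
    · have := Nat.choose_succ_right_eq N m
      rw [← Nat.cast_sub h]
      exact_mod_cast this
    · rw [Nat.choose_eq_zero_of_lt h, Nat.choose_eq_zero_of_lt (by omega)]; simp
  have hode : C k * (1 - X ^ 2) * derivative (derivative Q) +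
      (C (s - b) + C (s + b + 1 + 2 * k * (N - 1)) * X) * derivative Q =
        C (jacobiEigenvalue N s b k n) * Q := by
    -- The eigenvector equation multiplied by `N.choose m`; the factors `N - m` are absorbed by `(m
    -- + 1) * N.choose (m + 1) = (N - m) * N.choose m`.
    have key : ∀ m : ℕ, jacobiEigenvalue N s b k n * Q.coeff m =
        jacobiEigenvalue N s b k m * Q.coeff m + (s - b) * (Q.coeff (m + 1) * (m + 1)) +
          k * (Q.coeff (m + 2) * (m + 2) * (m + 1)) := by
      intro m
      have h1 := congrFun ha m
      rw [jacobiShift, Pi.smul_apply, smul_eq_mul] at h1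
      have h2 := hch m
      have h3 := hch (m + 1)
      push_cast at h3
      simp only [hcoeff]
      linear_combination (-(N.choose m : ℝ)) * h1 - (s - b) * a (m + 1) * h2 -
        k * a (m + 2) * ((m + 1) * h3 + (N - (m + 1)) * h2)
    ext m
    rw [coeff_C_mul, key, jacobiEigenvalue]
    simp only [mul_sub, sub_mul, add_mul, mul_one, coeff_add, coeff_sub, mul_assoc, coeff_C_mul]
    rcases m with _ | _ | m
    · simp [coeff_derivative]
      ring
    · simp [coeff_derivative, coeff_X_pow_mul', coeff_X_mul]
      ring
    · simp only [coeff_X_mul, coeff_X_pow_mul, coeff_derivative]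
      push_cast
      ring
  have hstep := jacobi_derivative_ode hode
  have hdeg : Q.natDegree ≤ n := natDegree_le_iff_coeff_eq_zero.2 fun m hm => by
    rw [hcoeff, ha0 m hm, mul_zero]
  have htop : 0 < (derivative^[n] Q).eval 1 := by
    have h1 := natDegree_iterate_derivative Q n
    rw [eq_C_of_natDegree_le_zero (h1.trans (by omega)), eval_C, coeff_iterate_derivative, hcoeff,
      zero_add, han, mul_one, nsmul_eq_mul]
    exact_mod_cast Nat.mul_pos (Nat.pos_of_ne_zero (by simp [Nat.descFactorial_eq_zero_iff_lt]))
      (Nat.choose_pos hn)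
  have hpos : ∀ i ≤ n, 0 < (derivative^[n - i] Q).eval 1 := by
    intro i
    induction i with
    | zero => intro _; simpa using htop
    | succ i ih =>
      intro hi
      obtain ⟨j, hj⟩ : ∃ j, n - i = j + 1 := ⟨n - i - 1, by omega⟩
      have ih' := ih (by omega)
      rw [hj] at ih'
      rw [show n - (i + 1) = j by omega]
      have h1 := congrArg (eval 1) (hstep j)
      simp only [eval_add, eval_mul, eval_sub, eval_C, eval_X, eval_one, eval_pow] at h1
      have hjn : j < n := by omega
      have h2 := jacobiEigenvalue_lt hk hs hb hjn hn
      have h3 : (j : ℝ) + 1 ≤ N := by exact_mod_cast hjn.trans_le hn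
      unfold jacobiEigenvalue at h2
      have h4 : 0 ≤ k * (N - 1 - j) := mul_nonneg hk.le (by linarith)
      have h5 : 0 < (2 * s + 1 + 2 * (k * (N - 1 - j))) * eval 1 (derivative^[j + 1] Q) :=
        mul_pos (by linarith) ih'
      have h6 : (n * (s + b + 1 + k * (2 * N - 1 - n)) - j * (s + b + 1 + k * (2 * N - 1 - j))) *
          eval 1 (derivative^[j] Q) =
            (2 * s + 1 + 2 * (k * (N - 1 - j))) * eval 1 (derivative^[j + 1] Q) := by
        unfold jacobiEigenvalue at h1
        linear_combination -h1
      rw [← h6] at h5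
      exact (mul_pos_iff_of_pos_left (by linarith)).1 h5
  have h := hpos n le_rfl
  rw [symmSum_const]
  simpa [hQ, eval_finsetSum] using h

/-! ### Column partitions: weights below them and their orbit sums. -/

theorem columnPartition_mem_zero_one (N n : ℕ) (i : Fin N) :
    columnPartition N n i = 0 ∨ columnPartition N n i = 1 := by
  rw [columnPartition]
  split_ifs <;> simp

theorem isBCDominant_columnPartition (N n : ℕ) : IsBCDominant (columnPartition N n) := by
  refine ⟨fun i j hij => ?_, fun i => ?_⟩
  · have : (i : ℕ) ≤ j := hij
    simp only [columnPartition]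
    split_ifs <;> omega
  · rcases columnPartition_mem_zero_one N n i with h | h <;> simp [h]

theorem card_filter_val_lt {N n : ℕ} (hn : n ≤ N) :
    (Finset.univ.filter fun i : Fin N => (i : ℕ) < n).card = n := by
  rw [Fin.card_filter_val_lt, min_eq_right hn]

theorem sum_columnPartition {N n : ℕ} (hn : n ≤ N) : ∑ i, columnPartition N n i = n := by
  simp only [columnPartition]
  rw [Finset.sum_ite, Finset.sum_const_zero, add_zero, Finset.sum_const, card_filter_val_lt hn]
  simp

/-- The difference is a sum of roots `e_i`, so every shorter column occurs, without a parity
condition. -/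
theorem columnPartition_dominanceLT {N m n : ℕ} (hm : m < n) (hn : n ≤ N) :
    BCDominanceLT (columnPartition N m) (columnPartition N n) := by
  constructor
  · intro h
    have h1 := sum_columnPartition hn
    rw [← h, sum_columnPartition (hm.le.trans hn)] at h1
    exact hm.ne (by exact_mod_cast h1)
  · have h : columnPartition N n - columnPartition N m =
        ∑ i ∈ Finset.univ.filter (fun i : Fin N => m ≤ (i : ℕ) ∧ (i : ℕ) < n),
          (Pi.single i 1 : Fin N → ℤ) := by
      funext j
      rw [Finset.sum_apply]
      simp only [Pi.single_apply, Pi.sub_apply, columnPartition]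
      rw [Finset.sum_ite_eq]
      simp only [Finset.mem_filter, Finset.mem_univ, true_and]
      split_ifs <;> omega
    rw [h]
    exact AddSubmonoid.sum_mem _ fun i _ => AddSubmonoid.subset_closure (Or.inl ⟨i, rfl⟩)

/-- These two linear functionals, nonnegative on positive roots, are all that is needed of the
dominance order: the first bounds the entries of a smaller dominant weight by `1`, the second bounds
its number of ones by `n`. -/
theorem nonneg_of_mem_closure_bcPositiveRoots {N : ℕ} {v : Fin N → ℤ}
    (hv : v ∈ AddSubmonoid.closure (bcPositiveRoots N)) :
    (∀ i : Fin N, (i : ℕ) = 0 → 0 ≤ v i) ∧ 0 ≤ ∑ i, v i := by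
  induction hv using AddSubmonoid.closure_induction with
  | mem α hα =>
    rcases hα with ⟨i, rfl⟩ | ⟨i, rfl⟩ | ⟨i, j, hij, rfl⟩ | ⟨i, j, hij, rfl⟩
    · refine ⟨fun l _ => ?_, by simp⟩
      rw [Pi.single_apply]; split_ifs <;> norm_num
    · refine ⟨fun l _ => ?_, by simp⟩
      rw [Pi.single_apply]; split_ifs <;> norm_num
    · refine ⟨fun l hl => ?_, by simp⟩
      have hlj : l ≠ j := fun h => by
        have : (i : ℕ) < j := hij
        subst h; omega
      rw [Pi.sub_apply, Pi.single_apply, Pi.single_apply, if_neg hlj]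
      split_ifs <;> norm_num
    · refine ⟨fun l _ => ?_, by simp [Finset.sum_add_distrib]⟩
      rw [Pi.add_apply, Pi.single_apply, Pi.single_apply]
      split_ifs <;> norm_num
  | zero => simp
  | add x y _ _ hx hy =>
    refine ⟨fun i hi => add_nonneg (hx.1 i hi) (hy.1 i hi), ?_⟩
    simp only [Pi.add_apply, Finset.sum_add_distrib]
    exact add_nonneg hx.2 hy.2

theorem exists_eq_columnPartition {N n : ℕ} (hn : n ≤ N) {ν : Fin N → ℤ} (hν : IsBCDominant ν)
    (h : BCDominanceLT ν (columnPartition N n)) : ∃ m < n, ν = columnPartition N m := by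
  obtain ⟨h0, hsum⟩ := nonneg_of_mem_closure_bcPositiveRoots h.2
  have h1 : ∀ i, ν i ≤ 1 := fun i => by
    have hN : 0 < N := Fin.pos i
    have e1 := h0 ⟨0, hN⟩ rfl
    rw [Pi.sub_apply] at e1
    have e2 : ν i ≤ ν ⟨0, hN⟩ := hν.1 (Fin.mk_le_of_le_val (Nat.zero_le _))
    rcases columnPartition_mem_zero_one N n ⟨0, hN⟩ with e3 | e3 <;> omega
  -- The entries are now `0` or `1` and decrease, so the ones occupy an initial segment of length
  -- `T.card`.
  set T := Finset.univ.filter fun i => ν i = 1 with hT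
  have hνT : ν = columnPartition N T.card := by
    funext i
    have e0 := hν.2 i
    have e1 := h1 i
    rw [columnPartition]
    split_ifs with hi
    · by_contra hne
      have hsub : T ⊆ Finset.Iio i := fun j hj => by
        rw [Finset.mem_Iio]
        by_contra hji
        have := hν.1 (not_lt.1 hji)
        rw [hT, Finset.mem_filter] at hj
        omega
      have := Finset.card_le_card hsub
      rw [Fin.card_Iio] at this
      omega
    · by_contra hne
      have hsub : Finset.Iic i ⊆ T := fun j hj => by
        rw [hT, Finset.mem_filter]
        have := hν.1 (Finset.mem_Iic.1 hj)
        have := h1 j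
        exact ⟨Finset.mem_univ _, by omega⟩
      have := Finset.card_le_card hsub
      rw [Fin.card_Iic] at this
      omega
  have hTN : T.card ≤ N := by simpa using Finset.card_le_univ T
  refine ⟨T.card, lt_of_le_of_ne ?_ fun he => h.1 (by rw [hνT, he]), hνT⟩
  simp only [Pi.sub_apply, Finset.sum_sub_distrib] at hsum
  rw [hνT, sum_columnPartition hn, sum_columnPartition hTN] at hsum
  omega

theorem mem_bcOrbit_columnPartition {N m : ℕ} (hm : m ≤ N) (μ : Fin N → ℤ) :
    μ ∈ bcOrbit (columnPartition N m) ↔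
      (∀ i, μ i = 0 ∨ μ i = 1 ∨ μ i = -1) ∧ (Finset.univ.filter fun i => μ i ≠ 0).card = m := by
  rw [bcOrbit, Finset.mem_image]
  constructor
  · rintro ⟨⟨g, ε⟩, -, rfl⟩
    refine ⟨fun i => ?_, ?_⟩
    · rcases columnPartition_mem_zero_one N m (g i) with h | h <;>
        rcases Int.units_eq_one_or (ε i) with h' | h' <;> simp [h, h']
    · refine Eq.trans ?_ (card_filter_val_lt hm)
      refine Finset.card_bij (fun i _ => g i) (fun i hi => ?_) (fun i _ j _ hij => g.injective hij)
        fun i hi => ⟨g.symm i, ?_, g.apply_symm_apply i⟩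
      · rw [Finset.mem_filter] at hi ⊢
        refine ⟨Finset.mem_univ _, ?_⟩
        by_contra hlt
        exact hi.2 (by simp [columnPartition, hlt])
      · rw [Finset.mem_filter] at hi ⊢
        exact ⟨Finset.mem_univ _, by simp [columnPartition, hi.2]⟩
  · rintro ⟨h1, h2⟩
    have hcard : Fintype.card {i // μ i ≠ 0} = Fintype.card {i : Fin N // (i : ℕ) < m} := by
      rw [Fintype.card_subtype, Fintype.card_subtype, h2, card_filter_val_lt hm]
    let e := Fintype.equivOfCardEq hcard
    refine ⟨⟨e.extendSubtype, fun i => if μ i = -1 then -1 else 1⟩, Finset.mem_univ _, ?_⟩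
    funext i
    by_cases hi : μ i = 0
    · have := e.extendSubtype_not_mem i (not_not.2 hi)
      simp [columnPartition, this, hi]
    · have := e.extendSubtype_mem i hi
      rcases h1 i with h | h | h
      · exact absurd h hi
      · simp [columnPartition, this, h]
      · simp [columnPartition, this, h]

/-- Group the orbit by support `S`: over each `S` the signs are free, so the sum factors into `∏_{i
∈ S} (e^{i t_i} + e^{-i t_i}) = ∏_{i ∈ S} 2 cos t_i`. -/
theorem bcOrbitSum_columnPartition {N m : ℕ} (hm : m ≤ N) (t : Fin N → ℝ) :
    bcOrbitSum (columnPartition N m) t =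
      (symmSum Finset.univ (Pi.single m (2 ^ m)) (fun i => Real.cos (t i)) : ℝ) := by
  have hmaps : ∀ μ ∈ bcOrbit (columnPartition N m),
      (Finset.univ.filter fun i => μ i ≠ 0) ∈ (Finset.univ : Finset (Fin N)).powersetCard m :=
    fun μ hμ => Finset.mem_powersetCard.2
      ⟨Finset.subset_univ _, ((mem_bcOrbit_columnPartition hm μ).1 hμ).2⟩
  rw [symmSum_single, bcOrbitSum, ← Finset.sum_fiberwise_of_maps_to hmaps, Finset.mul_sum,
    Complex.ofReal_sum]
  refine Finset.sum_congr rfl fun S hS => ?_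
  have hS' := (Finset.mem_powersetCard.1 hS).2
  have hfib : (bcOrbit (columnPartition N m)).filter
      (fun μ => (Finset.univ.filter fun i => μ i ≠ 0) = S) =
        Fintype.piFinset fun i => if i ∈ S then ({1, -1} : Finset ℤ) else {0} := by
    ext μ
    rw [Finset.mem_filter, mem_bcOrbit_columnPartition hm, Fintype.mem_piFinset]
    constructor
    · rintro ⟨⟨h1, -⟩, rfl⟩ i
      by_cases hi : μ i = 0
      · simp [hi]
      · simpa [hi] using h1 i
    · intro h
      have hSμ : (Finset.univ.filter fun i => μ i ≠ 0) = S := by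
        ext i
        have := h i
        by_cases hi : i ∈ S
        · rw [if_pos hi] at this
          simp only [Finset.mem_insert, Finset.mem_singleton] at this
          rcases this with h | h <;> simp [h, hi]
        · rw [if_neg hi] at this
          simpa [hi] using this
      refine ⟨⟨fun i => ?_, by rw [hSμ, hS']⟩, hSμ⟩
      have := h i
      split_ifs at this
      · exact Or.inr (by simpa using this)
      · exact Or.inl (by simpa using this)
  rw [hfib]
  have hexp : ∀ μ : Fin N → ℤ, Complex.exp (Complex.I * ((∑ i, (μ i : ℝ) * t i : ℝ) : ℂ)) =
      ∏ i, Complex.exp (Complex.I * ((μ i : ℂ) * t i)) := fun μ => by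
    rw [← Complex.exp_sum, ← Finset.mul_sum]
    push_cast
    rfl
  simp only [hexp]
  rw [← Finset.prod_univ_sum (fun i => if i ∈ S then ({1, -1} : Finset ℤ) else {0})
    fun i (j : ℤ) => Complex.exp (Complex.I * ((j : ℂ) * t i))]
  have hfac : ∀ i, ∑ j ∈ (if i ∈ S then ({1, -1} : Finset ℤ) else {0}),
      Complex.exp (Complex.I * ((j : ℂ) * t i)) =
        if i ∈ S then (2 : ℂ) * Real.cos (t i) else 1 := fun i => by
    split_ifs
    · rw [Finset.sum_pair (by norm_num), Complex.ofReal_cos, Complex.cos]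
      push_cast
      ring_nf
    · simp
  simp only [hfac]
  rw [Finset.prod_ite_mem, Finset.univ_inter, Finset.prod_mul_distrib, Finset.prod_const, hS']
  push_cast
  rfl

/-! ### The regularized weight and Green's identity for it. -/

/-- The weight `∏ (1 - x_i + ε)^s (1 + x_i + ε)^b ∏_{i < j} ((x_i - x_j)² + ε)^k`, a smooth
regularization of the Jacobi weight. -/
noncomputable def jacobiWeight {N : ℕ} (s b k ε : ℝ) (x : Fin N → ℝ) : ℝ :=
  (∏ i, (1 - x i + ε) ^ s * (1 + x i + ε) ^ b) *
    ∏ i, ∏ j ∈ Finset.Ioi i, ((x i - x j) ^ 2 + ε) ^ k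

/-- The logarithmic derivative of the regularized Jacobi weight in the angular coordinates. -/
noncomputable def jacobiWeightLogDeriv {N : ℕ} (s b k ε : ℝ) (t : Fin N → ℝ) :
    (Fin N → ℝ) →L[ℝ] ℝ :=
  ∑ i, (s * Real.sin (t i) / (1 - Real.cos (t i) + ε) -
      b * Real.sin (t i) / (1 + Real.cos (t i) + ε)) • ContinuousLinearMap.proj i +
    ∑ i, ∑ j ∈ Finset.Ioi i,
      (2 * k * (Real.cos (t i) - Real.cos (t j)) / ((Real.cos (t i) - Real.cos (t j)) ^ 2 + ε)) •
        (Real.sin (t j) • ContinuousLinearMap.proj j -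
          Real.sin (t i) • ContinuousLinearMap.proj i)

section Weight

variable {N : ℕ}

theorem one_sub_cos_add_pos {ε : ℝ} (hε : 0 < ε) (r : ℝ) : 0 < 1 - Real.cos r + ε := by
  linarith [Real.cos_le_one r]

theorem one_add_cos_add_pos {ε : ℝ} (hε : 0 < ε) (r : ℝ) : 0 < 1 + Real.cos r + ε := by
  linarith [Real.neg_one_le_cos r]

theorem jacobiWeight_eq_exp (s b k : ℝ) {ε : ℝ} (hε : 0 < ε) (t : Fin N → ℝ) :
    jacobiWeight s b k ε (fun i => Real.cos (t i)) =
      Real.exp (∑ i, (s * Real.log (1 - Real.cos (t i) + ε) +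
          b * Real.log (1 + Real.cos (t i) + ε)) +
        ∑ i, ∑ j ∈ Finset.Ioi i,
          k * Real.log ((Real.cos (t i) - Real.cos (t j)) ^ 2 + ε)) := by
  rw [jacobiWeight, Real.exp_add, Real.exp_sum, Real.exp_sum]
  congr 1
  · refine Finset.prod_congr rfl fun i _ => ?_
    rw [Real.exp_add, Real.rpow_def_of_pos (one_sub_cos_add_pos hε _),
      Real.rpow_def_of_pos (one_add_cos_add_pos hε _), mul_comm s, mul_comm b]
  · refine Finset.prod_congr rfl fun i _ => ?_
    rw [Real.exp_sum]
    refine Finset.prod_congr rfl fun j _ => ?_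
    rw [Real.rpow_def_of_pos (by positivity), mul_comm k]

theorem hasFDerivAt_cos_apply (t : Fin N → ℝ) (i : Fin N) :
    HasFDerivAt (fun t : Fin N → ℝ => Real.cos (t i))
      (-Real.sin (t i) • (ContinuousLinearMap.proj i : (Fin N → ℝ) →L[ℝ] ℝ)) t :=
  (ContinuousLinearMap.proj (R := ℝ) (φ := fun _ : Fin N => ℝ) i).hasFDerivAt.cos

theorem hasFDerivAt_sin_apply (t : Fin N → ℝ) (i : Fin N) :
    HasFDerivAt (fun t : Fin N → ℝ => Real.sin (t i))
      (Real.cos (t i) • (ContinuousLinearMap.proj i : (Fin N → ℝ) →L[ℝ] ℝ)) t :=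
  (ContinuousLinearMap.proj (R := ℝ) (φ := fun _ : Fin N => ℝ) i).hasFDerivAt.sin

theorem hasFDerivAt_jacobiWeight (s b k : ℝ) {ε : ℝ} (hε : 0 < ε) (t : Fin N → ℝ) :
    HasFDerivAt (fun t : Fin N → ℝ => jacobiWeight s b k ε (fun i => Real.cos (t i)))
      (jacobiWeight s b k ε (fun i => Real.cos (t i)) • jacobiWeightLogDeriv s b k ε t) t := by
  have hfun : (fun t : Fin N → ℝ => jacobiWeight s b k ε (fun i => Real.cos (t i))) = _ :=
    funext fun t => jacobiWeight_eq_exp s b k hε t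
  rw [hfun, jacobiWeight_eq_exp s b k hε]
  refine HasFDerivAt.exp ?_
  refine HasFDerivAt.add (HasFDerivAt.fun_sum fun i _ => ?_)
    (HasFDerivAt.fun_sum fun i _ => HasFDerivAt.fun_sum fun j _ => ?_)
  · have h1 := (((hasFDerivAt_cos_apply t i).const_sub 1).add_const ε).log
      (one_sub_cos_add_pos hε _).ne' |>.const_mul s
    have h2 := (((hasFDerivAt_cos_apply t i).const_add 1).add_const ε).log
      (one_add_cos_add_pos hε _).ne' |>.const_mul b
    refine (h1.add h2).congr_fderiv ?_
    ext v
    simp only [add_apply, smul_apply,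
      neg_apply, ContinuousLinearMap.proj_apply, smul_eq_mul]
    ring
  · have h1 := (((((hasFDerivAt_cos_apply t i).sub (hasFDerivAt_cos_apply t j)).pow 2).add_const
      ε).log (by positivity)).const_mul k
    refine h1.congr_fderiv ?_
    ext v
    simp only [smul_apply, sub_apply,
      ContinuousLinearMap.proj_apply, smul_eq_mul, nsmul_eq_mul]
    simp
    ring

theorem continuous_jacobiWeight_cos (s b k : ℝ) {ε : ℝ} (hε : 0 < ε) :
    Continuous (fun t : Fin N → ℝ => jacobiWeight s b k ε (fun i => Real.cos (t i))) :=
  continuous_iff_continuousAt.2 fun t => (hasFDerivAt_jacobiWeight s b k hε t).continuousAt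

/-- The `i`-th component `∂_i f g - f ∂_i g` of the Wronskian field of `f = symmSum a` and
`g = symmSum c`. -/
def symmSumWronskian (a c : ℕ → ℝ) (i : Fin N) (x : Fin N → ℝ) : ℝ :=
  symmSumDeriv a i x * symmSum Finset.univ c x - symmSum Finset.univ a x * symmSumDeriv c i x

/-- The quotient by `x_i - x_j` of the difference of the components of the Wronskian field, each
multiplied by `1 - x²`. -/
def symmSumWronskianPair (a c : ℕ → ℝ) (i j : Fin N) (x : Fin N → ℝ) : ℝ :=
  symmSumPair a i j x * symmSum Finset.univ c x - symmSum Finset.univ a x * symmSumPair c i j x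

/-- Both polynomials are affine in `x_i`, so the terms containing `x_i` cancel: the `i`-th component
does not depend on `x_i`. Hence its own derivative contributes nothing to the divergence. -/
theorem symmSumWronskian_eq (a c : ℕ → ℝ) (i : Fin N) (x : Fin N → ℝ) :
    symmSumWronskian a c i x =
      symmSum (Finset.univ.erase i) (fun m => a (m + 1)) x * symmSum (Finset.univ.erase i) c x -
        symmSum (Finset.univ.erase i) a x *
          symmSum (Finset.univ.erase i) (fun m => c (m + 1)) x := by
  rw [symmSumWronskian, symmSumDeriv, symmSumDeriv, symmSum_erase (Finset.mem_univ i) a,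
    symmSum_erase (Finset.mem_univ i) c]
  ring

theorem continuous_symmSumWronskian (a c : ℕ → ℝ) (i : Fin N) :
    Continuous (symmSumWronskian a c i) := by
  unfold symmSumWronskian symmSumDeriv
  exact ((continuous_symmSum _ _).mul (continuous_symmSum _ _)).sub
    ((continuous_symmSum _ _).mul (continuous_symmSum _ _))

theorem continuous_symmSumWronskianPair (a c : ℕ → ℝ) (i j : Fin N) :
    Continuous (symmSumWronskianPair a c i j) := by
  have h : ∀ d : ℕ → ℝ, Continuous (symmSumPair d i j) := fun d =>
    ((continuous_symmSum _ _).sub (continuous_symmSum _ _)).sub (continuous_symmSum _ _)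
  exact ((h a).mul (continuous_symmSum _ _)).sub ((continuous_symmSum _ _).mul (h c))

theorem sub_mul_symmSumWronskianPair (a c : ℕ → ℝ) {i j : Fin N} (hij : i ≠ j) (x : Fin N → ℝ) :
    (x i - x j) * symmSumWronskianPair a c i j x =
      (1 - x i ^ 2) * symmSumWronskian a c i x - (1 - x j ^ 2) * symmSumWronskian a c j x := by
  simp only [symmSumWronskianPair, symmSumWronskian]
  linear_combination symmSum Finset.univ c x * sub_mul_symmSumPair a hij x -
    symmSum Finset.univ a x * sub_mul_symmSumPair c hij x

theorem differentiable_symmSumWronskian_cos (a c : ℕ → ℝ) (i : Fin N) :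
    Differentiable ℝ (fun t : Fin N → ℝ => symmSumWronskian a c i fun l => Real.cos (t l)) := by
  have hcos : Differentiable ℝ (fun t : Fin N → ℝ => fun l => Real.cos (t l)) := by fun_prop
  have h : ∀ (u : Finset (Fin N)) (d : ℕ → ℝ),
      Differentiable ℝ (fun t : Fin N → ℝ => symmSum u d fun l => Real.cos (t l)) :=
    fun u d => (differentiable_symmSum u d).comp hcos
  exact ((h _ _).mul (h _ _)).sub ((h _ _).mul (h _ _))

theorem fderiv_symmSumWronskian_cos (a c : ℕ → ℝ) (i : Fin N) (t : Fin N → ℝ) :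
    fderiv ℝ (fun t : Fin N → ℝ => symmSumWronskian a c i fun l => Real.cos (t l)) t
      (Pi.single i 1) = 0 := by
  rw [← (differentiable_symmSumWronskian_cos a c i t).lineDeriv_eq_fderiv, lineDeriv]
  have h : ∀ τ : ℝ, symmSumWronskian a c i
      (fun l => Real.cos ((t + τ • (Pi.single i 1 : Fin N → ℝ)) l)) =
        symmSumWronskian a c i fun l => Real.cos (t l) := by
    intro τ
    have e : ∀ d : ℕ → ℝ, symmSum (Finset.univ.erase i) d
        (fun l => Real.cos ((t + τ • (Pi.single i 1 : Fin N → ℝ)) l)) =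
          symmSum (Finset.univ.erase i) d fun l => Real.cos (t l) := fun d =>
      symmSum_congr_arg d fun l hl => by
        simp [Pi.single_eq_of_ne (Finset.ne_of_mem_erase hl)]
    simp only [symmSumWronskian_eq, e]
  simp only [h, deriv_const]

/-- The divergence of the regularized weight times the Wronskian field, divided by the weight. -/
noncomputable def wronskianDivergence (s b k : ℝ) (a c : ℕ → ℝ) (ε : ℝ) (x : Fin N → ℝ) : ℝ :=
  ∑ i, (x i + s * ((1 - x i ^ 2) / (1 - x i + ε)) - b * ((1 - x i ^ 2) / (1 + x i + ε))) *
      symmSumWronskian a c i x -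
    2 * k * ∑ i, ∑ j ∈ Finset.Ioi i,
      (x i - x j) ^ 2 / ((x i - x j) ^ 2 + ε) * symmSumWronskianPair a c i j x

theorem continuous_wronskianDivergence_cos (s b k : ℝ) (a c : ℕ → ℝ) {ε : ℝ} (hε : 0 < ε) :
    Continuous (fun t : Fin N → ℝ =>
      wronskianDivergence s b k a c ε fun i => Real.cos (t i)) := by
  have hcos : Continuous (fun t : Fin N → ℝ => fun l => Real.cos (t l)) := by fun_prop
  have h1 : ∀ i, Continuous (fun t : Fin N → ℝ => symmSumWronskian a c i fun l => Real.cos (t l)) :=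
    fun i => (continuous_symmSumWronskian a c i).comp hcos
  have h2 : ∀ i j, Continuous (fun t : Fin N → ℝ =>
      symmSumWronskianPair a c i j fun l => Real.cos (t l)) :=
    fun i j => (continuous_symmSumWronskianPair a c i j).comp hcos
  have hd1 : ∀ i, ∀ t : Fin N → ℝ, 1 - Real.cos (t i) + ε ≠ 0 :=
    fun i t => (one_sub_cos_add_pos hε _).ne'
  have hd2 : ∀ i, ∀ t : Fin N → ℝ, 1 + Real.cos (t i) + ε ≠ 0 :=
    fun i t => (one_add_cos_add_pos hε _).ne'
  have hd3 : ∀ i j, ∀ t : Fin N → ℝ, (Real.cos (t i) - Real.cos (t j)) ^ 2 + ε ≠ 0 :=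
    fun i j t => by positivity
  unfold wronskianDivergence
  refine Continuous.sub (continuous_finsetSum _ fun i _ => Continuous.mul ?_ (h1 i))
    (continuous_const.mul (continuous_finsetSum _ fun i _ => continuous_finsetSum _ fun j _ =>
      Continuous.mul ?_ (h2 i j)))
  · have e1 := hd1 i
    have e2 := hd2 i
    fun_prop (disch := assumption)
  · have e3 := hd3 i j
    fun_prop (disch := assumption)

/-- One factor `x_i - x_j` in the numerator comes from the weight and the other from
`sub_mul_symmSumWronskianPair`; their product keeps the quotient by `(x_i - x_j)² + ε` bounded as `ε
→ 0`. -/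
theorem jacobiWeightLogDeriv_add_eq (s b k : ℝ) (a c : ℕ → ℝ) (ε : ℝ) (t : Fin N → ℝ) :
    (jacobiWeightLogDeriv s b k ε t) (fun i => Real.sin (t i) *
        symmSumWronskian a c i fun l => Real.cos (t l)) +
      ∑ i, Real.cos (t i) * (symmSumWronskian a c i fun l => Real.cos (t l)) =
        wronskianDivergence s b k a c ε fun l => Real.cos (t l) := by
  simp only [jacobiWeightLogDeriv, wronskianDivergence, add_apply,
    sum_apply, smul_apply, sub_apply,
    ContinuousLinearMap.proj_apply, smul_eq_mul]
  have h1 : ∀ i, ∀ j ∈ Finset.Ioi i,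
      2 * k * (Real.cos (t i) - Real.cos (t j)) / ((Real.cos (t i) - Real.cos (t j)) ^ 2 + ε) *
        (Real.sin (t j) * (Real.sin (t j) * symmSumWronskian a c j fun l => Real.cos (t l)) -
          Real.sin (t i) * (Real.sin (t i) * symmSumWronskian a c i fun l => Real.cos (t l))) =
      -(2 * k * ((Real.cos (t i) - Real.cos (t j)) ^ 2 /
        ((Real.cos (t i) - Real.cos (t j)) ^ 2 + ε) *
          symmSumWronskianPair a c i j fun l => Real.cos (t l))) := fun i j hij => by
    have e := sub_mul_symmSumWronskianPair a c (Finset.mem_Ioi.1 hij).ne fun l => Real.cos (t l)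
    simp only [← Real.sin_sq] at e
    linear_combination (2 * k * (Real.cos (t i) - Real.cos (t j)) /
      ((Real.cos (t i) - Real.cos (t j)) ^ 2 + ε)) * e
  rw [Finset.sum_congr rfl fun i _ => Finset.sum_congr rfl (h1 i)]
  simp only [Finset.sum_neg_distrib, ← Finset.mul_sum, ← Real.sin_sq]
  rw [add_right_comm, ← Finset.sum_add_distrib, ← sub_eq_add_neg]
  congr 1
  exact Finset.sum_congr rfl fun i _ => by ring

theorem integral_jacobiWeight_mul_wronskianDivergence (s b k : ℝ) (a c : ℕ → ℝ) {ε : ℝ}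
    (hε : 0 < ε) :
    ∫ t in Set.Icc (0 : Fin (N + 1) → ℝ) (fun _ => 2 * Real.pi),
      jacobiWeight s b k ε (fun i => Real.cos (t i)) *
        wronskianDivergence s b k a c ε (fun i => Real.cos (t i)) = 0 := by
  set W : (Fin (N + 1) → ℝ) → ℝ := fun t => jacobiWeight s b k ε (fun i => Real.cos (t i)) with hW
  set D : Fin (N + 1) → (Fin (N + 1) → ℝ) → ℝ :=
    fun i t => symmSumWronskian a c i fun l => Real.cos (t l) with hD
  have hderiv : ∀ i t, HasFDerivAt (fun t => W t * Real.sin (t i) * D i t)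
      ((W t * Real.sin (t i)) • fderiv ℝ (D i) t + D i t • (W t • (Real.cos (t i) •
        (ContinuousLinearMap.proj i : (Fin (N + 1) → ℝ) →L[ℝ] ℝ)) +
          Real.sin (t i) • (W t • jacobiWeightLogDeriv s b k ε t))) t := fun i t =>
    ((hasFDerivAt_jacobiWeight s b k hε t).mul (hasFDerivAt_sin_apply t i)).mul
      (differentiable_symmSumWronskian_cos a c i t).hasFDerivAt
  have hdiv : ∀ t, ∑ i, ((W t * Real.sin (t i)) • fderiv ℝ (D i) t + D i t • (W t •
      (Real.cos (t i) • (ContinuousLinearMap.proj i : (Fin (N + 1) → ℝ) →L[ℝ] ℝ)) +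
          Real.sin (t i) • (W t • jacobiWeightLogDeriv s b k ε t))) (Pi.single i 1) =
      W t * wronskianDivergence s b k a c ε (fun i => Real.cos (t i)) := fun t => by
    have hv : (jacobiWeightLogDeriv s b k ε t) (fun i => Real.sin (t i) * D i t) =
        ∑ i, Real.sin (t i) * D i t * jacobiWeightLogDeriv s b k ε t (Pi.single i 1) := by
      conv_lhs => rw [pi_eq_sum_univ' (fun i => Real.sin (t i) * D i t), map_sum]
      exact Finset.sum_congr rfl fun i _ => by rw [map_smul, smul_eq_mul]
    rw [← jacobiWeightLogDeriv_add_eq, hv, ← Finset.sum_add_distrib, Finset.mul_sum]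
    refine Finset.sum_congr rfl fun i _ => ?_
    simp only [add_apply, smul_apply,
      ContinuousLinearMap.proj_apply, smul_eq_mul, Pi.single_eq_same]
    rw [hD, fderiv_symmSumWronskian_cos]
    ring
  have hle : (0 : Fin (N + 1) → ℝ) ≤ fun _ => 2 * Real.pi := fun _ => Real.two_pi_pos.le
  have key := MeasureTheory.integral_divergence_of_hasFDerivAt_off_countable' 0
    (fun _ => 2 * Real.pi) hle (fun i t => W t * Real.sin (t i) * D i t) _ ∅ Set.countable_empty
    (fun i => (continuous_iff_continuousAt.2 fun t => (hderiv i t).continuousAt).continuousOn)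
    (fun t _ i => hderiv i t) (by
      simp only [hdiv]
      exact (((continuous_jacobiWeight_cos s b k hε).mul
        (continuous_wronskianDivergence_cos s b k a c hε)).continuousOn).integrableOn_compact
          isCompact_Icc)
  simp only [hdiv] at key
  -- Only face terms remain, and they vanish because the `i`-th component carries the factor `sin
  -- t_i`, which is zero at `t_i = 0` and `t_i = 2π`.
  rw [key]
  simp

end Weight

/-! ### Regular points and integrability of the singular weight. -/

open MeasureTheory Filter Topology

theorem ae_linearMap_ne {N : ℕ} (L : (Fin N → ℝ) →ₗ[ℝ] ℝ) (hL : L ≠ 0) (c : ℝ) :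
    ∀ᵐ t : Fin N → ℝ, L t ≠ c := by
  by_cases h : ∃ t₀, L t₀ = c
  · obtain ⟨t₀, ht₀⟩ := h
    have hS : AffineSubspace.mk' t₀ (LinearMap.ker L) ≠ ⊤ := fun h => by
      have h1 := congrArg AffineSubspace.direction h
      rw [AffineSubspace.direction_mk', AffineSubspace.direction_top] at h1
      exact hL (LinearMap.ker_eq_top.1 h1)
    have h0 := Measure.addHaar_affineSubspace (volume : Measure (Fin N → ℝ)) _ hS
    rw [ae_iff]
    refine measure_mono_null (fun t ht => ?_) h0
    rw [Set.mem_ofPred_eq, not_not] at ht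
    simp [AffineSubspace.mem_mk', ht, ht₀]
  · exact Eventually.of_forall fun t ht => h ⟨t, ht⟩

/-- The points of the torus lying on none of the hyperplanes `⟨α, t⟩ ∈ 2 π ℤ`. -/
def IsBCRegular {N : ℕ} (t : Fin N → ℝ) : Prop :=
  (∀ i, Real.sin (t i) ≠ 0) ∧ ∀ i j, i ≠ j → Real.cos (t i) ≠ Real.cos (t j)

/-- The irregular points lie on countably many affine hyperplanes. -/
theorem ae_isBCRegular (N : ℕ) : ∀ᵐ t : Fin N → ℝ, IsBCRegular t := by
  have h1 : ∀ᵐ t : Fin N → ℝ, ∀ i, ∀ z : ℤ, t i ≠ z * Real.pi :=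
    ae_all_iff.2 fun i => ae_all_iff.2 fun z => ae_linearMap_ne (LinearMap.proj i)
      (fun h => by simpa using LinearMap.congr_fun h (Pi.single i 1)) _
  have h2 : ∀ᵐ t : Fin N → ℝ, ∀ i j, i ≠ j → ∀ z : ℤ,
      t j - t i ≠ 2 * z * Real.pi ∧ t j + t i ≠ 2 * z * Real.pi := by
    refine ae_all_iff.2 fun i => ae_all_iff.2 fun j => eventually_imp_distrib_left.2 fun hij => ?_
    have hsub : (Pi.single i 1 : Fin N → ℝ) j - (Pi.single i 1 : Fin N → ℝ) i ≠ 0 := by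
      simp [Pi.single_eq_of_ne hij.symm]
    have hadd : (Pi.single i 1 : Fin N → ℝ) j + (Pi.single i 1 : Fin N → ℝ) i ≠ 0 := by
      simp [Pi.single_eq_of_ne hij.symm]
    refine ae_all_iff.2 fun z => ?_
    filter_upwards [ae_linearMap_ne (LinearMap.proj j - LinearMap.proj i)
        (fun h => hsub ((LinearMap.sub_apply _ _ _).symm.trans
          (LinearMap.congr_fun h (Pi.single i 1)))) (2 * z * Real.pi),
      ae_linearMap_ne (LinearMap.proj j + LinearMap.proj i)
        (fun h => hadd ((LinearMap.add_apply _ _ _).symm.trans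
          (LinearMap.congr_fun h (Pi.single i 1)))) (2 * z * Real.pi)] with t e1 e2
    exact ⟨fun h => e1 ((LinearMap.sub_apply _ _ _).trans h),
      fun h => e2 ((LinearMap.add_apply _ _ _).trans h)⟩
  filter_upwards [h1, h2] with t h1 h2
  refine ⟨fun i h => ?_, fun i j hij h => ?_⟩
  · obtain ⟨z, hz⟩ := Real.sin_eq_zero_iff.1 h
    exact h1 i z hz.symm
  · obtain ⟨z, hz | hz⟩ := Real.cos_eq_cos_iff.1 h
    · exact (h2 i j hij z).1 (by linarith)
    · exact (h2 i j hij z).2 (by linarith)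

theorem intervalIntegrable_sin_sq_rpow {r : ℝ} (hr : -1 / 2 < r) (hr0 : r ≤ 0) (a b : ℝ) :
    IntervalIntegrable (fun t => (Real.sin t ^ 2) ^ r) volume a b := by
  have hper : Function.Periodic (fun t => (Real.sin t ^ 2) ^ r) Real.pi := fun t => by
    simp [Real.sin_add_pi]
  have hmeas : Measurable fun t => (Real.sin t ^ 2) ^ r := by fun_prop
  have h1 : IntervalIntegrable (fun t => (Real.sin t ^ 2) ^ r) volume 0 (Real.pi / 2) := by
    -- Jordan's inequality `sin t ≥ 2t/π` bounds the integrand by a multiple of `t^(2r)`, integrable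
    -- since `2r > -1`. Reflection and `π`-periodicity do the rest.
    have h0 := ((intervalIntegral.intervalIntegrable_rpow' (a := 0) (b := Real.pi / 2)
      (show -1 < 2 * r by linarith)).const_mul ((2 / Real.pi) ^ (2 * r)))
    refine h0.mono_fun hmeas.aestronglyMeasurable ?_
    refine (ae_restrict_iff' measurableSet_uIoc).2 (Eventually.of_forall fun t ht => ?_)
    rw [Set.uIoc_of_le (by positivity)] at ht
    have hpi := Real.pi_pos
    have hs := Real.mul_le_sin ht.1.le ht.2
    have hpos : 0 < 2 / Real.pi * t := mul_pos (by positivity) ht.1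
    have ht0 := ht.1
    beta_reduce
    rw [Real.norm_of_nonneg (by positivity), Real.norm_of_nonneg (by positivity),
      ← Real.mul_rpow (by positivity) ht.1.le, Real.rpow_mul hpos.le]
    refine Real.rpow_le_rpow_of_nonpos (by positivity) ?_ hr0
    rw [Real.rpow_two]
    gcongr
  have h2 : IntervalIntegrable (fun t => (Real.sin t ^ 2) ^ r) volume (Real.pi / 2) Real.pi := by
    have := h1.comp_sub_left Real.pi
    simp only [Real.sin_pi_sub, sub_zero] at this
    rw [show Real.pi - Real.pi / 2 = Real.pi / 2 by ring] at this
    exact this.symm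
  exact hper.intervalIntegrable₀ Real.pi_ne_zero (h1.trans h2) a b

theorem integrableOn_prod_sin_sq_rpow (N : ℕ) {r : ℝ} (hr : -1 / 2 < r) (hr0 : r ≤ 0) :
    IntegrableOn (fun t : Fin N → ℝ => ∏ i, (Real.sin (t i) ^ 2) ^ r)
      (Set.Icc 0 fun _ => 2 * Real.pi) := by
  rw [← Set.pi_univ_Icc, IntegrableOn, volume_pi, Measure.restrict_pi_pi]
  refine Integrable.fintype_prod (f := fun _ t => (Real.sin t ^ 2) ^ r) fun i => ?_
  exact (intervalIntegrable_iff_integrableOn_Icc_of_le Real.two_pi_pos.le).1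
    (intervalIntegrable_sin_sq_rpow hr hr0 _ _)

/-! ### Removal of the regularization by dominated convergence. -/

section Limit

variable {N : ℕ}

/-- Split the exponent as `(s - r) + r`: the first power is increasing with base at most `3`, the
second is decreasing, so `ε` may be dropped from its base. -/
theorem add_rpow_le {r s u ε : ℝ} (hr : r ≤ 0) (hrs : r ≤ s) (hu : 0 < u) (hu2 : u ≤ 2)
    (hε : 0 ≤ ε) (hε1 : ε ≤ 1) : (u + ε) ^ s ≤ 3 ^ (s - r) * u ^ r := by
  have h : (u + ε) ^ s = (u + ε) ^ (s - r) * (u + ε) ^ r := by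
    rw [← Real.rpow_add (by linarith), sub_add_cancel]
  rw [h]
  refine mul_le_mul (Real.rpow_le_rpow (by linarith) (by linarith) (by linarith))
    (Real.rpow_le_rpow_of_nonpos hu (by linarith) hr) (by positivity) (by positivity)

theorem one_sub_cos_pos {r : ℝ} (h : Real.sin r ≠ 0) : 0 < 1 - Real.cos r := by
  have := Real.sin_sq_add_cos_sq r
  have : 0 < Real.sin r ^ 2 := by positivity
  nlinarith [Real.cos_le_one r, Real.neg_one_le_cos r]

theorem one_add_cos_pos {r : ℝ} (h : Real.sin r ≠ 0) : 0 < 1 + Real.cos r := by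
  have := Real.sin_sq_add_cos_sq r
  have : 0 < Real.sin r ^ 2 := by positivity
  nlinarith [Real.cos_le_one r, Real.neg_one_le_cos r]

theorem jacobiWeight_pos {s b k ε : ℝ} (hε : 0 ≤ ε) {t : Fin N → ℝ} (ht : IsBCRegular t) :
    0 < jacobiWeight s b k ε (fun i => Real.cos (t i)) := by
  refine mul_pos (Finset.prod_pos fun i _ => mul_pos (Real.rpow_pos_of_pos ?_ _)
    (Real.rpow_pos_of_pos ?_ _)) (Finset.prod_pos fun i _ => Finset.prod_pos fun j hj =>
      Real.rpow_pos_of_pos ?_ _)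
  · linarith [one_sub_cos_pos (ht.1 i)]
  · linarith [one_add_cos_pos (ht.1 i)]
  · have := sub_ne_zero.2 (ht.2 i j (Finset.mem_Ioi.1 hj).ne)
    positivity

/-- An integrable bound, uniform in `ε`, for the regularized Jacobi weight. -/
noncomputable def jacobiWeightBound (s b k r : ℝ) (t : Fin N → ℝ) : ℝ :=
  (∏ _i : Fin N, (3 : ℝ) ^ (s - r) * 3 ^ (b - r)) * (∏ i : Fin N, ∏ _j ∈ Finset.Ioi i, (5 : ℝ) ^ k) *
    ∏ i, (Real.sin (t i) ^ 2) ^ r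

theorem jacobiWeight_le_bound {s b k r ε : ℝ} (hk : 0 < k) (hr : r ≤ 0) (hrs : r ≤ s)
    (hrb : r ≤ b) (hε : 0 ≤ ε) (hε1 : ε ≤ 1) {t : Fin N → ℝ} (ht : IsBCRegular t) :
    jacobiWeight s b k ε (fun i => Real.cos (t i)) ≤ jacobiWeightBound s b k r t := by
  have h1 : ∀ i, (1 - Real.cos (t i) + ε) ^ s * (1 + Real.cos (t i) + ε) ^ b ≤
      3 ^ (s - r) * 3 ^ (b - r) * (Real.sin (t i) ^ 2) ^ r := fun i => by
    have e1 := one_sub_cos_pos (ht.1 i)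
    have e2 := one_add_cos_pos (ht.1 i)
    rw [show Real.sin (t i) ^ 2 = (1 - Real.cos (t i)) * (1 + Real.cos (t i)) by
      rw [Real.sin_sq]; ring, Real.mul_rpow e1.le e2.le, mul_mul_mul_comm]
    refine mul_le_mul (add_rpow_le hr hrs e1 ?_ hε hε1) (add_rpow_le hr hrb e2 ?_ hε hε1)
      (by positivity) (by positivity)
    · linarith [Real.neg_one_le_cos (t i)]
    · linarith [Real.cos_le_one (t i)]
  have h2 : ∀ i j, ((Real.cos (t i) - Real.cos (t j)) ^ 2 + ε) ^ k ≤ 5 ^ k := fun i j => by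
    refine Real.rpow_le_rpow (by positivity) ?_ hk.le
    nlinarith [Real.neg_one_le_cos (t i), Real.cos_le_one (t i), Real.neg_one_le_cos (t j),
      Real.cos_le_one (t j)]
  rw [jacobiWeightBound, mul_right_comm, ← Finset.prod_mul_distrib]
  have hp1 : ∀ i, 0 ≤ (1 - Real.cos (t i) + ε) ^ s * (1 + Real.cos (t i) + ε) ^ b := fun i =>
    mul_nonneg (Real.rpow_nonneg (by linarith [Real.cos_le_one (t i)]) _)
      (Real.rpow_nonneg (by linarith [Real.neg_one_le_cos (t i)]) _)
  refine mul_le_mul (Finset.prod_le_prod (fun i _ => hp1 i) fun i _ => h1 i)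
    (Finset.prod_le_prod (fun i _ => Finset.prod_nonneg fun j _ => by positivity) fun i _ =>
      Finset.prod_le_prod (fun j _ => by positivity) fun j _ => h2 i j)
    (Finset.prod_nonneg fun i _ => Finset.prod_nonneg fun j _ => by positivity)
    (Finset.prod_nonneg fun i _ => by positivity)

theorem integrableOn_jacobiWeightBound (s b k : ℝ) {r : ℝ} (hr : -1 / 2 < r) (hr0 : r ≤ 0) :
    IntegrableOn (jacobiWeightBound s b k r : (Fin N → ℝ) → ℝ) (Set.Icc 0 fun _ => 2 * Real.pi) :=
  (integrableOn_prod_sin_sq_rpow N hr hr0).const_mul _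

theorem measurable_jacobiWeight_cos (s b k ε : ℝ) :
    Measurable (fun t : Fin N → ℝ => jacobiWeight s b k ε fun i => Real.cos (t i)) := by
  unfold jacobiWeight
  fun_prop

/-- A common exponent for both endpoints turns the bound on the one-variable factors into a power of
`(1 - cos t)(1 + cos t) = sin² t`. -/
theorem exists_bound_exponent {s b : ℝ} (hs : -1 / 2 < s) (hb : -1 / 2 < b) :
    ∃ r : ℝ, -1 / 2 < r ∧ r ≤ 0 ∧ r ≤ s ∧ r ≤ b :=
  ⟨min 0 (min s b), lt_min (by norm_num) (lt_min hs hb), min_le_left _ _,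
    (min_le_right _ _).trans (min_le_left _ _), (min_le_right _ _).trans (min_le_right _ _)⟩

theorem integrableOn_jacobiWeight_mul {s b k : ℝ} (hk : 0 < k) (hs : -1 / 2 < s)
    (hb : -1 / 2 < b) {f : (Fin N → ℝ) → ℝ} (hf : Continuous f) :
    IntegrableOn (fun t : Fin N → ℝ => jacobiWeight s b k 0 (fun i => Real.cos (t i)) * f t)
      (Set.Icc 0 fun _ => 2 * Real.pi) := by
  obtain ⟨r, hr, hr0, hrs, hrb⟩ := exists_bound_exponent hs hb
  refine IntegrableOn.mul_continuousOn ?_ hf.continuousOn isCompact_Icc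
  refine (integrableOn_jacobiWeightBound s b k hr hr0).mono'
    (measurable_jacobiWeight_cos s b k 0).aestronglyMeasurable ?_
  filter_upwards [ae_restrict_of_ae (ae_isBCRegular N)] with t ht
  rw [Real.norm_of_nonneg (jacobiWeight_pos le_rfl ht).le]
  exact jacobiWeight_le_bound hk hr0 hrs hrb le_rfl zero_le_one ht

theorem continuousAt_jacobiWeight {s b k : ℝ} {t : Fin N → ℝ} (ht : IsBCRegular t) :
    ContinuousAt (fun ε => jacobiWeight s b k ε fun i => Real.cos (t i)) 0 := by
  unfold jacobiWeight
  refine ContinuousAt.mul (tendsto_finsetProd _ fun i _ => ContinuousAt.mul ?_ ?_)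
    (tendsto_finsetProd _ fun i _ => tendsto_finsetProd _ fun j hj => ?_)
  · refine ContinuousAt.rpow_const (by fun_prop) (Or.inl ?_)
    simpa using (one_sub_cos_pos (ht.1 i)).ne'
  · refine ContinuousAt.rpow_const (by fun_prop) (Or.inl ?_)
    simpa using (one_add_cos_pos (ht.1 i)).ne'
  · refine ContinuousAt.rpow_const (f := fun ε => (Real.cos (t i) - Real.cos (t j)) ^ 2 + ε)
      (by fun_prop) (Or.inl ?_)
    simpa using sub_ne_zero.2 (ht.2 i j (Finset.mem_Ioi.1 hj).ne)

theorem continuousAt_wronskianDivergence (s b k : ℝ) (a c : ℕ → ℝ) {t : Fin N → ℝ}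
    (ht : IsBCRegular t) :
    ContinuousAt (fun ε => wronskianDivergence s b k a c ε fun i => Real.cos (t i)) 0 := by
  unfold wronskianDivergence
  refine ContinuousAt.sub (tendsto_finsetSum _ fun i _ => ContinuousAt.mul ?_ continuousAt_const)
    (ContinuousAt.mul continuousAt_const (tendsto_finsetSum _ fun i _ => tendsto_finsetSum _
      fun j hj => ContinuousAt.mul ?_ continuousAt_const))
  · have e1 : 1 - Real.cos (t i) + 0 ≠ 0 := by simpa using (one_sub_cos_pos (ht.1 i)).ne'
    have e2 : 1 + Real.cos (t i) + 0 ≠ 0 := by simpa using (one_add_cos_pos (ht.1 i)).ne'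
    fun_prop (disch := assumption)
  · have e3 : (Real.cos (t i) - Real.cos (t j)) ^ 2 + 0 ≠ 0 := by
      simpa using sub_ne_zero.2 (ht.2 i j (Finset.mem_Ioi.1 hj).ne)
    fun_prop (disch := assumption)

theorem wronskianDivergence_zero (s b k : ℝ) (a c : ℕ → ℝ) {t : Fin N → ℝ} (ht : IsBCRegular t) :
    wronskianDivergence s b k a c 0 (fun i => Real.cos (t i)) =
      symmSum Finset.univ (jacobiShift N s b k a) (fun i => Real.cos (t i)) *
          symmSum Finset.univ c (fun i => Real.cos (t i)) -
        symmSum Finset.univ a (fun i => Real.cos (t i)) *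
          symmSum Finset.univ (jacobiShift N s b k c) (fun i => Real.cos (t i)) := by
  rw [← jacobi_operator_symmSum, ← jacobi_operator_symmSum, wronskianDivergence]
  have h1 : ∀ i, (1 - Real.cos (t i) ^ 2) / (1 - Real.cos (t i) + 0) = 1 + Real.cos (t i) :=
    fun i => by
      rw [add_zero, div_eq_iff (one_sub_cos_pos (ht.1 i)).ne']; ring
  have h2 : ∀ i, (1 - Real.cos (t i) ^ 2) / (1 + Real.cos (t i) + 0) = 1 - Real.cos (t i) :=
    fun i => by
      rw [add_zero, div_eq_iff (one_add_cos_pos (ht.1 i)).ne']; ring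
  have h3 : ∀ i, ∀ j ∈ Finset.Ioi i, (Real.cos (t i) - Real.cos (t j)) ^ 2 /
      ((Real.cos (t i) - Real.cos (t j)) ^ 2 + 0) *
        symmSumWronskianPair a c i j (fun l => Real.cos (t l)) =
      symmSumPair a i j (fun l => Real.cos (t l)) *
          symmSum Finset.univ c (fun l => Real.cos (t l)) -
        symmSum Finset.univ a (fun l => Real.cos (t l)) *
          symmSumPair c i j (fun l => Real.cos (t l)) := fun i j hj => by
    have := sub_ne_zero.2 (ht.2 i j (Finset.mem_Ioi.1 hj).ne)
    rw [add_zero, div_self (by positivity), one_mul, symmSumWronskianPair]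
  rw [Finset.sum_congr rfl fun i _ => Finset.sum_congr rfl (h3 i)]
  simp only [h1, h2, symmSumWronskian, Finset.sum_sub_distrib, ← Finset.sum_mul, ← Finset.mul_sum]
  have h4 : ∀ A B u : Fin N → ℝ, ∀ f g : ℝ, ∑ i, u i * (A i * g - f * B i) =
      (∑ i, u i * A i) * g - f * ∑ i, u i * B i := fun A B u f g => by
    rw [Finset.sum_mul, Finset.mul_sum, ← Finset.sum_sub_distrib]
    exact Finset.sum_congr rfl fun i _ => by ring
  rw [h4]
  ring

/-- A bound, uniform in `ε`, for the divergence of the Wronskian field. -/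
def wronskianBound (s b k : ℝ) (a c : ℕ → ℝ) (x : Fin N → ℝ) : ℝ :=
  ∑ i, (1 + |s| * 2 + |b| * 2) * |symmSumWronskian a c i x| +
    2 * k * ∑ i, ∑ j ∈ Finset.Ioi i, |symmSumWronskianPair a c i j x|

theorem abs_wronskianDivergence_le (s b : ℝ) {k : ℝ} (hk : 0 < k) (a c : ℕ → ℝ) {ε : ℝ}
    (hε : 0 < ε) (t : Fin N → ℝ) :
    |wronskianDivergence s b k a c ε fun i => Real.cos (t i)| ≤
      wronskianBound s b k a c fun i => Real.cos (t i) := by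
  unfold wronskianDivergence wronskianBound
  refine (abs_sub _ _).trans (add_le_add ((Finset.abs_sum_le_sum_abs _ _).trans
    (Finset.sum_le_sum fun i _ => ?_)) ?_)
  · rw [abs_mul]
    refine mul_le_mul_of_nonneg_right ?_ (abs_nonneg _)
    have hc1 := Real.cos_le_one (t i)
    have hc2 := Real.neg_one_le_cos (t i)
    have h0 : 0 ≤ 1 - Real.cos (t i) ^ 2 := by nlinarith
    have e1 : |(1 - Real.cos (t i) ^ 2) / (1 - Real.cos (t i) + ε)| ≤ 2 := by
      rw [abs_of_nonneg (div_nonneg h0 (one_sub_cos_add_pos hε _).le),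
        div_le_iff₀ (one_sub_cos_add_pos hε _)]
      nlinarith
    have e2 : |(1 - Real.cos (t i) ^ 2) / (1 + Real.cos (t i) + ε)| ≤ 2 := by
      rw [abs_of_nonneg (div_nonneg h0 (one_add_cos_add_pos hε _).le),
        div_le_iff₀ (one_add_cos_add_pos hε _)]
      nlinarith
    refine (abs_sub _ _).trans (add_le_add ((abs_add_le _ _).trans (add_le_add
      (Real.abs_cos_le_one _) ?_)) ?_)
    · rw [abs_mul]; gcongr
    · rw [abs_mul]; gcongr
  · rw [abs_mul, abs_of_pos (by positivity : 0 < 2 * k)]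
    refine mul_le_mul_of_nonneg_left ((Finset.abs_sum_le_sum_abs _ _).trans
      (Finset.sum_le_sum fun i _ => (Finset.abs_sum_le_sum_abs _ _).trans
        (Finset.sum_le_sum fun j _ => ?_))) (by positivity)
    rw [abs_mul]
    refine mul_le_of_le_one_left (abs_nonneg _) ?_
    rw [abs_of_nonneg (by positivity), div_le_one (by positivity)]
    linarith

theorem continuous_wronskianBound_cos (s b k : ℝ) (a c : ℕ → ℝ) :
    Continuous fun t : Fin N → ℝ => wronskianBound s b k a c fun i => Real.cos (t i) := by
  have h1 := continuous_symmSumWronskian (N := N) a c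
  have h2 := continuous_symmSumWronskianPair (N := N) a c
  have h : Continuous (wronskianBound s b k a c : (Fin N → ℝ) → ℝ) := by
    unfold wronskianBound
    fun_prop
  exact h.comp (by fun_prop)

theorem integral_jacobiWeight_symmetric {s b k : ℝ} (hk : 0 < k) (hs : -1 / 2 < s)
    (hb : -1 / 2 < b) (a c : ℕ → ℝ) :
    ∫ t in Set.Icc (0 : Fin (N + 1) → ℝ) (fun _ => 2 * Real.pi),
      jacobiWeight s b k 0 (fun i => Real.cos (t i)) *
        (symmSum Finset.univ (jacobiShift (N + 1) s b k a) (fun i => Real.cos (t i)) *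
          symmSum Finset.univ c (fun i => Real.cos (t i)) -
        symmSum Finset.univ a (fun i => Real.cos (t i)) *
          symmSum Finset.univ (jacobiShift (N + 1) s b k c) (fun i => Real.cos (t i))) = 0 := by
  obtain ⟨r, hr, hr0, hrs, hrb⟩ := exists_bound_exponent hs hb
  have hreg := ae_restrict_of_ae (s := Set.Icc 0 fun _ => 2 * Real.pi) (ae_isBCRegular (N + 1))
  have hlim := tendsto_integral_filter_of_dominated_convergence
    (μ := volume.restrict (Set.Icc (0 : Fin (N + 1) → ℝ) fun _ => 2 * Real.pi))
    (l := 𝓝[>] (0 : ℝ))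
    (F := fun ε t => jacobiWeight s b k ε (fun i => Real.cos (t i)) *
      wronskianDivergence s b k a c ε (fun i => Real.cos (t i)))
    (f := fun t => jacobiWeight s b k 0 (fun i => Real.cos (t i)) *
      wronskianDivergence s b k a c 0 (fun i => Real.cos (t i)))
    (fun t => jacobiWeightBound s b k r t * wronskianBound s b k a c fun i => Real.cos (t i))
    ?_ ?_ ?_ ?_
  · have hzero : ∀ᶠ ε in 𝓝[>] (0 : ℝ),
        ∫ t in Set.Icc (0 : Fin (N + 1) → ℝ) (fun _ => 2 * Real.pi),
          jacobiWeight s b k ε (fun i => Real.cos (t i)) *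
            wronskianDivergence s b k a c ε (fun i => Real.cos (t i)) = 0 := by
      filter_upwards [self_mem_nhdsWithin] with ε hε
      exact integral_jacobiWeight_mul_wronskianDivergence s b k a c hε
    have h0 := tendsto_nhds_unique_of_eventuallyEq hlim tendsto_const_nhds hzero
    refine Eq.trans (integral_congr_ae ?_) h0
    filter_upwards [hreg] with t ht
    rw [wronskianDivergence_zero s b k a c ht]
  · filter_upwards [self_mem_nhdsWithin] with ε hε
    exact ((continuous_jacobiWeight_cos s b k hε).mul
      (continuous_wronskianDivergence_cos s b k a c hε)).aestronglyMeasurable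
  · filter_upwards [Ioc_mem_nhdsGT (zero_lt_one : (0 : ℝ) < 1)] with ε hε
    filter_upwards [hreg] with t ht
    rw [norm_mul, Real.norm_of_nonneg (jacobiWeight_pos hε.1.le ht).le]
    exact mul_le_mul (jacobiWeight_le_bound hk hr0 hrs hrb hε.1.le hε.2 ht)
      (abs_wronskianDivergence_le s b hk a c hε.1 t) (norm_nonneg _)
      ((jacobiWeight_pos hε.1.le ht).le.trans
        (jacobiWeight_le_bound hk hr0 hrs hrb hε.1.le hε.2 ht))
  · exact (integrableOn_jacobiWeightBound s b k hr hr0).mul_continuousOn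
      (continuous_wronskianBound_cos s b k a c).continuousOn isCompact_Icc
  · filter_upwards [hreg] with t ht
    exact ((continuousAt_jacobiWeight ht).mul
      (continuousAt_wronskianDivergence s b k a c ht)).tendsto.mono_left nhdsWithin_le_nhds

end Limit

/-! ### The pairing, its orthogonality and definiteness, and the comparison of weights. -/

section Pairing

variable {N : ℕ}

theorem continuous_symmSum_cos (a : ℕ → ℝ) :
    Continuous fun t : Fin N → ℝ => symmSum Finset.univ a fun i => Real.cos (t i) :=
  (continuous_symmSum _ a).comp (by fun_prop)

theorem integrableOn_jacobiWeight_symmSum_mul {s b k : ℝ} (hk : 0 < k) (hs : -1 / 2 < s)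
    (hb : -1 / 2 < b) (a c : ℕ → ℝ) :
    IntegrableOn (fun t : Fin N → ℝ => jacobiWeight s b k 0 (fun i => Real.cos (t i)) *
      (symmSum Finset.univ a (fun i => Real.cos (t i)) *
        symmSum Finset.univ c (fun i => Real.cos (t i)))) (Set.Icc 0 fun _ => 2 * Real.pi) :=
  integrableOn_jacobiWeight_mul hk hs hb ((continuous_symmSum_cos a).mul (continuous_symmSum_cos c))

/-- The `L²` pairing of multilinear symmetric polynomials for the Jacobi weight, in terms of
their coefficients. -/
noncomputable def jacobiPairing (N : ℕ) {s b k : ℝ} (hk : 0 < k) (hs : -1 / 2 < s)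
    (hb : -1 / 2 < b) : (ℕ → ℝ) →ₗ[ℝ] (ℕ → ℝ) →ₗ[ℝ] ℝ :=
  LinearMap.mk₂ ℝ (fun a c => ∫ t in Set.Icc (0 : Fin N → ℝ) (fun _ => 2 * Real.pi),
      jacobiWeight s b k 0 (fun i => Real.cos (t i)) *
        (symmSum Finset.univ a (fun i => Real.cos (t i)) *
          symmSum Finset.univ c (fun i => Real.cos (t i))))
    (fun a a' c => by
      rw [← integral_add (integrableOn_jacobiWeight_symmSum_mul hk hs hb a c)
        (integrableOn_jacobiWeight_symmSum_mul hk hs hb a' c)]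
      exact integral_congr_ae (Eventually.of_forall fun t => by
        simp only [symmSum_add]; ring))
    (fun r a c => by
      rw [smul_eq_mul, ← integral_const_mul]
      exact integral_congr_ae (Eventually.of_forall fun t => by
        simp only [symmSum_smul]; ring))
    (fun a c c' => by
      rw [← integral_add (integrableOn_jacobiWeight_symmSum_mul hk hs hb a c)
        (integrableOn_jacobiWeight_symmSum_mul hk hs hb a c')]
      exact integral_congr_ae (Eventually.of_forall fun t => by
        simp only [symmSum_add]; ring))
    (fun r a c => by
      rw [smul_eq_mul, ← integral_const_mul]
      exact integral_congr_ae (Eventually.of_forall fun t => by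
        simp only [symmSum_smul]; ring))

theorem jacobiPairing_shift {s b k : ℝ} (hk : 0 < k) (hs : -1 / 2 < s) (hb : -1 / 2 < b)
    (a c : ℕ → ℝ) :
    jacobiPairing (N + 1) hk hs hb (jacobiShift (N + 1) s b k a) c =
      jacobiPairing (N + 1) hk hs hb a (jacobiShift (N + 1) s b k c) := by
  have h := integral_jacobiWeight_symmetric (N := N) hk hs hb a c
  simp only [mul_sub] at h
  rw [integral_sub (integrableOn_jacobiWeight_symmSum_mul hk hs hb _ _)
    (integrableOn_jacobiWeight_symmSum_mul hk hs hb _ _)] at h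
  exact sub_eq_zero.1 h

theorem jacobiPairing_eq_zero_of_eigenvector {n : ℕ} (hn : n ≤ N + 1) {s b k : ℝ} (hk : 0 < k)
    (hs : -1 / 2 < s) (hb : -1 / 2 < b) {a : ℕ → ℝ}
    (ha : jacobiShift (N + 1) s b k a = jacobiEigenvalue (N + 1) s b k n • a)
    {c : ℕ → ℝ} (hc : ∀ m, n ≤ m → c m = 0) : jacobiPairing (N + 1) hk hs hb a c = 0 := by
  have key : ∀ r ≤ n, ∀ c : ℕ → ℝ, (∀ m, r ≤ m → c m = 0) →
      jacobiPairing (N + 1) hk hs hb a c = 0 := by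
    intro r
    induction r with
    | zero =>
      intro _ c hc
      rw [show c = 0 from funext fun m => hc m (Nat.zero_le m), map_zero]
    | succ r ih =>
      intro hr c hc
      -- Subtracting `λ_r c` removes the top coefficient, so the induction hypothesis applies.
      -- Symmetry then gives `(λ_n - λ_r) ⟨a, c⟩ = 0` with `λ_r < λ_n`.
      have h1 := ih (by omega) (jacobiShift (N + 1) s b k c - jacobiEigenvalue (N + 1) s b k r • c)
        fun m hm => by
          rw [Pi.sub_apply, Pi.smul_apply, smul_eq_mul, jacobiShift, hc (m + 1) (by omega),
            hc (m + 2) (by omega)]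
          rcases hm.eq_or_lt with rfl | hm
          · ring
          · rw [hc m hm]; ring
      have h2 := jacobiPairing_shift (N := N) hk hs hb a c
      rw [map_sub, map_smul, ← h2, ha, map_smul, LinearMap.smul_apply, smul_eq_mul, smul_eq_mul,
        ← sub_mul] at h1
      exact (mul_eq_zero.1 h1).resolve_left
        (sub_pos.2 (jacobiEigenvalue_lt hk hs hb hr hn)).ne'
  exact key n le_rfl c hc

theorem symmSum_cos_eq_zero_of_jacobiPairing_self {s b k : ℝ} (hk : 0 < k) (hs : -1 / 2 < s)
    (hb : -1 / 2 < b) {a : ℕ → ℝ} (ha : jacobiPairing N hk hs hb a a = 0) (t : Fin N → ℝ) :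
    symmSum Finset.univ a (fun i => Real.cos (t i)) = 0 := by
  have hreg := ae_restrict_of_ae (s := Set.Icc 0 fun _ => 2 * Real.pi) (ae_isBCRegular N)
  have h1 : (fun t : Fin N → ℝ => jacobiWeight s b k 0 (fun i => Real.cos (t i)) *
      (symmSum Finset.univ a (fun i => Real.cos (t i)) *
        symmSum Finset.univ a (fun i => Real.cos (t i))))
      =ᵐ[volume.restrict (Set.Icc 0 fun _ => 2 * Real.pi)] 0 := by
    refine (integral_eq_zero_iff_of_nonneg_ae ?_
      (integrableOn_jacobiWeight_symmSum_mul hk hs hb a a)).1 ha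
    filter_upwards [hreg] with t ht
    exact mul_nonneg (jacobiWeight_pos le_rfl ht).le (mul_self_nonneg _)
  have h2 : (fun t : Fin N → ℝ => symmSum Finset.univ a fun i => Real.cos (t i))
      =ᵐ[volume.restrict (Set.Icc 0 fun _ => 2 * Real.pi)] fun _ => 0 := by
    filter_upwards [hreg, h1] with t ht h
    exact mul_self_eq_zero.1 ((mul_eq_zero.1 h).resolve_left (jacobiWeight_pos le_rfl ht).ne')
  have hU : Set.Icc (0 : Fin N → ℝ) (fun _ => 2 * Real.pi) ⊆
      closure (interior (Set.Icc 0 fun _ => 2 * Real.pi)) := by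
    rw [← Set.pi_univ_Icc, interior_pi_set Set.finite_univ, closure_pi_set]
    refine Set.pi_mono fun i _ => ?_
    rw [interior_Icc, Pi.zero_apply, closure_Ioo Real.two_pi_pos.ne]
  have h3 := Measure.eqOn_of_ae_eq h2 (continuous_symmSum_cos a).continuousOn
    continuousOn_const hU
  -- The function depends on `t` only through `cos t_i`, so any `t` can be folded into `[0, π]^N`,
  -- inside the box.
  have h4 := h3 (x := fun i => Real.arccos (Real.cos (t i)))
    ⟨fun i => Real.arccos_nonneg _, fun i => (Real.arccos_le_pi _).trans (by
      linarith [Real.pi_pos])⟩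
  simpa only [Real.cos_arccos (Real.neg_one_le_cos _) (Real.cos_le_one _)] using h4

theorem abs_rpow_two_mul (y k : ℝ) : |y| ^ (2 * k) = (y ^ 2) ^ k := by
  rw [Real.rpow_mul (abs_nonneg y), Real.rpow_two, sq_abs]

/-- The constant relating the weight in angular coordinates to the Jacobi weight. -/
noncomputable def bcWeightConst (N : ℕ) (k₁ k₃ : ℝ) : ℝ :=
  (∏ _i : Fin N, ((1 : ℝ) / 2) ^ k₁) * ∏ i : Fin N, ∏ _j ∈ Finset.Ioi i, ((1 : ℝ) / 4) ^ k₃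

theorem bcWeightConst_pos (N : ℕ) (k₁ k₃ : ℝ) : 0 < bcWeightConst N k₁ k₃ := by
  unfold bcWeightConst
  positivity

/-- Half-angle formulas give `sin²(t/2) = (1 - cos t)/2`, and `cos t_i - cos t_j` is `-2` times the
product of the two half-angle sines. Regularity is used to combine the powers of `1 - cos t_i`,
which need a positive base. -/
theorem bcWeight_eq (k₁ k₂ k₃ : ℝ) {t : Fin N → ℝ} (ht : IsBCRegular t) :
    bcWeight k₁ k₂ k₃ t =
      bcWeightConst N k₁ k₃ * jacobiWeight (k₁ + k₂) k₂ k₃ 0 (fun i => Real.cos (t i)) := by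
  rw [bcWeight, bcWeightConst, jacobiWeight, mul_mul_mul_comm]
  congr 1
  · rw [← Finset.prod_mul_distrib]
    refine Finset.prod_congr rfl fun i _ => ?_
    have e1 := one_sub_cos_pos (ht.1 i)
    have e2 := one_add_cos_pos (ht.1 i)
    have hs : Real.sin (t i / 2) ^ 2 = 1 / 2 * (1 - Real.cos (t i)) := by
      have h := Real.cos_sq (t i / 2)
      rw [mul_div_cancel₀ _ (two_ne_zero' ℝ)] at h
      rw [Real.sin_sq, h]; ring
    have hs2 : Real.sin (t i) ^ 2 = (1 - Real.cos (t i)) * (1 + Real.cos (t i)) := by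
      rw [Real.sin_sq]; ring
    rw [abs_rpow_two_mul, abs_rpow_two_mul, hs, hs2, Real.mul_rpow (by norm_num) e1.le,
      Real.mul_rpow e1.le e2.le, add_zero, add_zero, Real.rpow_add e1]
    ring
  · rw [← Finset.prod_mul_distrib]
    refine Finset.prod_congr rfl fun i _ => ?_
    rw [← Finset.prod_mul_distrib]
    refine Finset.prod_congr rfl fun j _ => ?_
    rw [abs_rpow_two_mul, abs_rpow_two_mul, ← Real.mul_rpow (sq_nonneg _) (sq_nonneg _),
      ← Real.mul_rpow (by norm_num) (by positivity), Real.cos_sub_cos]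
    congr 1
    ring

/-- The trigonometric polynomial `∑ a_m e_m(cos t_1, …, cos t_N)`. -/
noncomputable def symmSumCos (N : ℕ) : (ℕ → ℝ) →ₗ[ℝ] ((Fin N → ℝ) → ℂ) where
  toFun a t := (symmSum Finset.univ a (fun i => Real.cos (t i)) : ℝ)
  map_add' a b := by
    funext t
    simp [symmSum_add]
  map_smul' c a := by
    funext t
    simp [symmSum_smul]

theorem bcOrbitSum_columnPartition_eq {m : ℕ} (hm : m ≤ N) :
    bcOrbitSum (columnPartition N m) = symmSumCos N (Pi.single m (2 ^ m)) :=
  funext fun t => bcOrbitSum_columnPartition hm t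

theorem integral_symmSumCos_mul_conj {k₁ k₂ k₃ : ℝ} (hk : 0 < k₃) (hs : -1 / 2 < k₁ + k₂)
    (hb : -1 / 2 < k₂) (a c : ℕ → ℝ) :
    IntegrableOn (fun t => symmSumCos N a t * (starRingEnd ℂ) (symmSumCos N c t) *
        (bcWeight k₁ k₂ k₃ t : ℂ)) (Set.Icc 0 fun _ => 2 * Real.pi) ∧
      ∫ t in Set.Icc (0 : Fin N → ℝ) (fun _ => 2 * Real.pi),
        symmSumCos N a t * (starRingEnd ℂ) (symmSumCos N c t) * (bcWeight k₁ k₂ k₃ t : ℂ) =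
          (bcWeightConst N k₁ k₃ * jacobiPairing N hk hs hb a c : ℝ) := by
  have hae : (fun t : Fin N → ℝ => ((bcWeightConst N k₁ k₃ *
      (jacobiWeight (k₁ + k₂) k₂ k₃ 0 (fun i => Real.cos (t i)) *
        (symmSum Finset.univ a (fun i => Real.cos (t i)) *
          symmSum Finset.univ c (fun i => Real.cos (t i)))) : ℝ) : ℂ))
      =ᵐ[volume.restrict (Set.Icc 0 fun _ => 2 * Real.pi)]
        fun t => symmSumCos N a t * (starRingEnd ℂ) (symmSumCos N c t) *
          (bcWeight k₁ k₂ k₃ t : ℂ) := by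
    filter_upwards [ae_restrict_of_ae (ae_isBCRegular N)] with t ht
    rw [bcWeight_eq k₁ k₂ k₃ ht]
    simp only [symmSumCos, LinearMap.coe_mk, AddHom.coe_mk, Complex.conj_ofReal]
    push_cast
    ring
  have hint := (integrableOn_jacobiWeight_symmSum_mul (N := N) hk hs hb a c).const_mul
    (bcWeightConst N k₁ k₃)
  refine ⟨Integrable.congr hint.ofReal hae, ?_⟩
  rw [← integral_congr_ae hae, integral_complex_ofReal, integral_const_mul]
  rfl

end Pairing

/-! ### Identification of the Heckman–Opdam polynomial and normalization. -/

section Main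

variable {N : ℕ}

theorem eq_sum_range_smul_single {n : ℕ} {c : ℕ → ℝ} (hc : ∀ m, n ≤ m → c m = 0) :
    c = ∑ m ∈ Finset.range n, (c m / 2 ^ m) • (Pi.single m (2 ^ m) : ℕ → ℝ) := by
  funext j
  rw [Finset.sum_apply]
  simp only [Pi.smul_apply, Pi.single_apply, smul_eq_mul, mul_ite, mul_zero]
  rw [Finset.sum_ite_eq]
  split_ifs with h
  · rw [div_mul_cancel₀ _ (by positivity)]
  · exact hc j (by simpa using h)

theorem isHeckmanOpdamPolynomial_columnPartition_iff {n : ℕ} (hn : n ≤ N + 1)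
    {k₁ k₂ k₃ : ℝ} (hk₃ : 0 < k₃) (hk₂ : -1 / 2 < k₂) (hk₁₂ : -1 / 2 < k₁ + k₂)
    (P : (Fin (N + 1) → ℝ) → ℂ) :
    IsHeckmanOpdamPolynomial k₁ k₂ k₃ (columnPartition (N + 1) n) P ↔
      P = symmSumCos (N + 1) ((2 : ℝ) ^ n •
        jacobiSeq (N + 1) (jacobiP (N + 1) k₂ k₃) (jacobiQ (N + 1) k₁ k₂ k₃) n) := by
  have hshift := jacobiShift_jacobiSeq hn hk₃ hk₂ hk₁₂
  set a := jacobiSeq (N + 1) (jacobiP (N + 1) k₂ k₃) (jacobiQ (N + 1) k₁ k₂ k₃) n with ha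
  have hlow : ∀ m, n ≤ m → ((2 : ℝ) ^ n • a - Pi.single n (2 ^ n) : ℕ → ℝ) m = 0 := fun m hm => by
    rw [Pi.sub_apply, Pi.smul_apply, smul_eq_mul]
    rcases hm.eq_or_lt with rfl | hm
    · rw [ha, jacobiSeq_self, Pi.single_eq_same]; ring
    · rw [ha, jacobiSeq_of_lt _ _ _ hm, Pi.single_eq_of_ne hm.ne']; ring
  have horth : ∀ c : ℕ → ℝ, (∀ m, n ≤ m → c m = 0) →
      jacobiPairing (N + 1) hk₃ hk₁₂ hk₂ ((2 : ℝ) ^ n • a) c = 0 := fun c hc => by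
    rw [map_smul, LinearMap.smul_apply,
      jacobiPairing_eq_zero_of_eigenvector hn hk₃ hk₁₂ hk₂ hshift hc, smul_zero]
  have hsingle : ∀ m < n, ∀ j, n ≤ j → (Pi.single m (2 ^ m) : ℕ → ℝ) j = 0 :=
    fun m hm j hj => Pi.single_eq_of_ne (by omega) _
  constructor
  · rintro ⟨h1, h2⟩
    let V : Submodule ℝ (ℕ → ℝ) :=
      { carrier := {c | ∀ m, n ≤ m → c m = 0}
        add_mem' := fun {c d} hc hd m hm => by rw [Pi.add_apply, hc m hm, hd m hm, add_zero]
        zero_mem' := fun _ _ => rfl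
        smul_mem' := fun r c hc m hm => by rw [Pi.smul_apply, hc m hm, smul_zero] }
    have hspan : P - bcOrbitSum (columnPartition (N + 1) n) ∈ V.map (symmSumCos (N + 1)) := by
      refine Submodule.span_le.2 ?_ h1
      rintro f ⟨ν, hν, hlt, rfl⟩
      obtain ⟨m, hm, rfl⟩ := exists_eq_columnPartition hn hν hlt
      exact ⟨Pi.single m (2 ^ m), hsingle m hm,
        (bcOrbitSum_columnPartition_eq (hm.le.trans hn)).symm⟩
    obtain ⟨c, hc, hcP⟩ := hspan
    rw [bcOrbitSum_columnPartition_eq hn] at hcP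
    have hP : P = symmSumCos (N + 1) (c + Pi.single n (2 ^ n)) := by
      rw [map_add, hcP, sub_add_cancel]
    -- The difference of the two candidates has degree below `n` and is orthogonal to all such
    -- degrees, hence to itself. It then vanishes as a function, which suffices: coefficients beyond
    -- the number of variables are invisible.
    set d := c + Pi.single n (2 ^ n) - (2 : ℝ) ^ n • a with hd
    have hdlow : ∀ m, n ≤ m → d m = 0 := fun m hm => by
      have e1 := hlow m hm
      have e2 := hc m hm
      simp only [hd, Pi.sub_apply, Pi.add_apply] at e1 ⊢
      linear_combination e2 - e1
    have hdorth : ∀ m < n, jacobiPairing (N + 1) hk₃ hk₁₂ hk₂ d (Pi.single m (2 ^ m)) = 0 := by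
      intro m hm
      have h3 := (h2 _ (isBCDominant_columnPartition (N + 1) m)
        (columnPartition_dominanceLT hm hn)).2
      rw [bcOrbitSum_columnPartition_eq (hm.le.trans hn), hP,
        (integral_symmSumCos_mul_conj hk₃ hk₁₂ hk₂ _ _).2] at h3
      have h4 := (mul_eq_zero.1 (Complex.ofReal_eq_zero.1 h3)).resolve_left
        (bcWeightConst_pos _ _ _).ne'
      rw [hd, map_sub, LinearMap.sub_apply, h4, horth _ (hsingle m hm), sub_zero]
    have hdd : jacobiPairing (N + 1) hk₃ hk₁₂ hk₂ d d = 0 := by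
      have h5 : ∀ e : ℕ → ℝ, (∀ m, n ≤ m → e m = 0) →
          jacobiPairing (N + 1) hk₃ hk₁₂ hk₂ d e = 0 := fun e he => by
        rw [eq_sum_range_smul_single he, map_sum]
        exact Finset.sum_eq_zero fun m hm => by
          rw [map_smul, hdorth m (Finset.mem_range.1 hm), smul_zero]
      exact h5 d hdlow
    have hd0 : symmSumCos (N + 1) d = 0 := funext fun t => by
      have := symmSum_cos_eq_zero_of_jacobiPairing_self hk₃ hk₁₂ hk₂ hdd t
      simp [symmSumCos, this]
    rw [hd, map_sub, sub_eq_zero] at hd0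
    rw [hP, hd0]
  · rintro rfl
    refine ⟨?_, fun ν hν hlt => ?_⟩
    · have h := congrArg (symmSumCos (N + 1)) (eq_sum_range_smul_single hlow)
      rw [bcOrbitSum_columnPartition_eq hn, ← map_sub, h, map_sum]
      refine Submodule.sum_mem _ fun m hm => ?_
      have hm' := Finset.mem_range.1 hm
      rw [map_smul, ← bcOrbitSum_columnPartition_eq (hm'.le.trans hn)]
      exact Submodule.smul_mem _ _ (Submodule.subset_span
        ⟨_, isBCDominant_columnPartition _ m, columnPartition_dominanceLT hm' hn, rfl⟩)
    · obtain ⟨m, hm, rfl⟩ := exists_eq_columnPartition hn hν hlt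
      rw [bcOrbitSum_columnPartition_eq (hm.le.trans hn)]
      have h := integral_symmSumCos_mul_conj hk₃ hk₁₂ hk₂ ((2 : ℝ) ^ n • a)
        (N := N + 1) (Pi.single m (2 ^ m))
      rw [horth _ (hsingle m hm), mul_zero, Complex.ofReal_zero] at h
      exact h

theorem eval_one_jacobiElementary_pos {n : ℕ} (hn : n ≤ N) {k₁ k₂ k₃ : ℝ} (hk₃ : 0 < k₃)
    (hk₂ : -1 / 2 < k₂) (hk₁₂ : -1 / 2 < k₁ + k₂) :
    0 < MvPolynomial.eval (fun _ => 1)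
      (jacobiElementary N (jacobiP N k₂ k₃) (jacobiQ N k₁ k₂ k₃) n) := by
  rw [eval_jacobiElementary]
  exact symmSum_one_pos hn hk₃ hk₁₂ hk₂ (jacobiShift_jacobiSeq hn hk₃ hk₂ hk₁₂)
    (jacobiSeq_self _ _ _ _) fun m hm => jacobiSeq_of_lt _ _ _ hm

theorem isNormalizedJacobiBC_columnPartition_iff {n : ℕ} (hn : 1 ≤ n) (hnN : n ≤ N)
    {k₁ k₂ k₃ : ℝ} (hk₃ : 0 < k₃) (hk₂ : -1 / 2 < k₂) (hk₁₂ : -1 / 2 < k₁ + k₂)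
    (R : MvPolynomial (Fin N) ℝ) :
    IsNormalizedJacobiBC k₁ k₂ k₃ (columnPartition N n) R ↔
      R = (MvPolynomial.eval (fun _ => 1)
          (jacobiElementary N (jacobiP N k₂ k₃) (jacobiQ N k₁ k₂ k₃) n))⁻¹ •
        jacobiElementary N (jacobiP N k₂ k₃) (jacobiQ N k₁ k₂ k₃) n := by
  have hpos := eval_one_jacobiElementary_pos hnN hk₃ hk₂ hk₁₂
  obtain ⟨N, rfl⟩ : ∃ M, N = M + 1 := ⟨N - 1, by omega⟩
  set E := jacobiElementary (N + 1) (jacobiP (N + 1) k₂ k₃) (jacobiQ (N + 1) k₁ k₂ k₃) n with hE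
  set P := symmSumCos (N + 1) ((2 : ℝ) ^ n •
    jacobiSeq (N + 1) (jacobiP (N + 1) k₂ k₃) (jacobiQ (N + 1) k₁ k₂ k₃) n) with hP
  have hPt : ∀ t, P t = (2 ^ n * MvPolynomial.eval (fun i => Real.cos (t i)) E : ℝ) := fun t => by
    rw [hE, eval_jacobiElementary, ← symmSum_smul]
    rfl
  have hP0 : P 0 = (2 ^ n * MvPolynomial.eval (fun _ => 1) E : ℝ) := by
    rw [hPt]
    simp
  have hP0' : P 0 ≠ 0 := by
    rw [hP0, Ne, Complex.ofReal_eq_zero]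
    positivity
  have hquot : ∀ t, P t / P 0 =
      (MvPolynomial.eval (fun i => Real.cos (t i)) ((MvPolynomial.eval (fun _ => 1) E)⁻¹ • E) : ℝ) :=
    fun t => by
      rw [hP0, hPt, ← Complex.ofReal_div, MvPolynomial.smul_eval,
        mul_div_mul_left _ _ (by positivity), div_eq_inv_mul]
  constructor
  · rintro ⟨P', hP', -, hR⟩
    rw [isHeckmanOpdamPolynomial_columnPartition_iff hnN hk₃ hk₂ hk₁₂] at hP'
    subst hP'
    -- The normalization condition only tests points with coordinates in `[-1, 1]`; a product of
    -- infinite sets determines a polynomial.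
    refine MvPolynomial.funext_set (fun _ => Set.Icc (-1) 1)
      (fun _ => Set.Icc_infinite (by norm_num)) fun x hx => ?_
    have h := hR fun i => Real.arccos (x i)
    rw [← hP, hquot, Complex.ofReal_inj] at h
    have hcos : (fun i => Real.cos (Real.arccos (x i))) = x := funext fun i =>
      Real.cos_arccos (hx i trivial).1 (hx i trivial).2
    rwa [hcos] at h
  · rintro rfl
    exact ⟨P, (isHeckmanOpdamPolynomial_columnPartition_iff hnN hk₃ hk₂ hk₁₂ P).2 rfl, hP0',
      fun t => (hquot t).symm⟩

end Main

theorem mainTheorem7 (N n : ℕ) (hn : 1 ≤ n) (hnN : n ≤ N) (k₁ k₂ k₃ : ℝ)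
    (hk₃ : 0 < k₃) (hk₂ : -1 / 2 < k₂) (hk₁₂ : -1 / 2 < k₁ + k₂) :
    (∃! R : MvPolynomial (Fin N) ℝ,
      IsNormalizedJacobiBC k₁ k₂ k₃ (columnPartition N n) R) ∧
    (∀ R : MvPolynomial (Fin N) ℝ,
      IsNormalizedJacobiBC k₁ k₂ k₃ (columnPartition N n) R →
        ∃ C : ℝ, C ≠ 0 ∧
          R = C • jacobiElementary N (jacobiP N k₂ k₃) (jacobiQ N k₁ k₂ k₃) n) ∧
    (∀ k₁' k₂' k₃' : ℝ, 0 < k₃' → -1 / 2 < k₂' → -1 / 2 < k₁' + k₂' →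
      jacobiP N k₂' k₃' = jacobiP N k₂ k₃ →
      jacobiQ N k₁' k₂' k₃' = jacobiQ N k₁ k₂ k₃ →
        ∀ R : MvPolynomial (Fin N) ℝ,
          IsNormalizedJacobiBC k₁ k₂ k₃ (columnPartition N n) R ↔
            IsNormalizedJacobiBC k₁' k₂' k₃' (columnPartition N n) R) := by
  have key := isNormalizedJacobiBC_columnPartition_iff hn hnN hk₃ hk₂ hk₁₂
  refine ⟨⟨_, (key _).2 rfl, fun R hR => (key R).1 hR⟩, fun R hR => ⟨_, inv_ne_zero
    (eval_one_jacobiElementary_pos hnN hk₃ hk₂ hk₁₂).ne', (key R).1 hR⟩, ?_⟩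
  intro k₁' k₂' k₃' hk₃' hk₂' hk₁₂' hp hq R
  rw [key, isNormalizedJacobiBC_columnPartition_iff hn hnN hk₃' hk₂' hk₁₂', hp, hq]
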